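/- **Setting.** Terms of differential dynamic logic (dL) are $e ::= x \mid c \mid e+\tilde e \mid e\cdot\tilde e \mid h(e_1,\dots,e_k) \mid (e)'$ with variables $x$ (each having a differential variable $x'$), rational constants $c$ and fixed function symbols $h$. The symbols are interpreted by $C^\infty$ functions $h:\mathbb R^k\to\mathbb R$ whose partial derivatives are represented by terms. An *extended term* contains no differential $(e)'$ and no differential variable. A *semianalytic formula* is a propositional combination of comparisons $=,\ge,>$ of extended terms. Let $x'=f(x)$ be a system of differential equations $x_1'=f_1,\dots,x_n'=f_n$ with pairwise distinct variables $x_i$ and extended terms $f_i$ (other variables may occur as parameters; they stay constant). The *Lie derivative* of an extended term $e$ is $\mathcal L e=\sum_i \frac{\partial e}{\partial x_i}f_i$, and $\dot e^{(0)}=e$, $\dot e^{(i+1)}=\mathcal L\,\dot e^{(i)}$. The calculus considered is the dL sequent calculus consisting of classical first-order logic with equality, all substitution instances of valid formulas of first-order real arithmetic, the assignment, duality, $\mathsf K$, $\mathsf G$, $\mathsf V$ and ODE-Barcan principles, the differential axioms (for constants, variables, sums, products and function symbols), the differential equation axioms DE, DW, DX, DMP, DI, DC, DG (with scalar linear ghosts),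 and the following two axioms: * (Uniq) $\langle x'=f(x)\,\&\,Q_1\wedge Q_2\rangle P\leftrightarrow \langle x'=f(x)\,\&\,Q_1\rangle P\wedge\langle x'=f(x)\,\&\,Q_2\rangle P$; * (Cont) $x=y\to\big(\langle x'=f(x)\,\&\,e>0\rangle\, x\ne y\leftrightarrow e>0\big)$, for fresh variables $y$ and for systems whose right-hand side has no zero. Assume that the extended terms have differential radicals: for every system and every extended term $e$ there are a rank $N\ge1$ and extended terms $g_0,\dots,g_{N-1}$ such that $\dot e^{(N)}=\sum_{i<N} g_i\,\dot e^{(i)}$ is provable. Fix such choices; $N$ below is the chosen rank of $e$ along $x'=f(x)$. Define $$\mathrm{Rad}(e)\equiv\bigwedge_{i=0}^{N-1}\dot e^{(i)}=0,$$ $$\mathrm{Prog}_{>}(e)\equiv\bigwedge_{i=0}^{N-2}\Big(\bigwedge_{j<i}\dot e^{(j)}=0\to\dot e^{(i)}\ge0\Big)\wedge\Big(\bigwedge_{j<N-1}\dot e^{(j)}=0\to\dot e^{(N-1)}>0\Big),$$ and $\mathrm{Prog}_{\ge}(e)\equiv\mathrm{Prog}_{>}(e)\vee\mathrm{Rad}(e)$.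 If a semianalytic formula $Q$ is provably equivalent to the normal form $\bigvee_i\big(\bigwedge_j e_{ij}\ge0\wedge\bigwedge_j\tilde e_{ij}>0\big)$ with extended terms $e_{ij},\tilde e_{ij}$, then its *progress formula* for this normal form is $$\mathrm{Prog}(Q)\equiv\bigvee_i\Big(\bigwedge_j\mathrm{Prog}_{\ge}(e_{ij})\wedge\bigwedge_j\mathrm{Prog}_{>}(\tilde e_{ij})\Big).$$ **Theorem (Analytic completeness with semianalytic domains).** Let $x'=f(x)$ be a system as above, $Q$ a semianalytic formula and $e$ an extended term. Then $Q$ has a normal form as above, and for every normal form of $Q$ the formula $$[x'=f(x)\,\&\,Q]\,e=0\;\leftrightarrow\;\Big(Q\to e=0\wedge\big(\mathrm{Prog}(Q)\to\mathrm{Rad}(e)\big)\Big)$$ is derivable in this calculus. -/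

import Mathlib

noncomputable section

namespace DL

/-! ## Syntax -/

/-- Fixed function symbols with their arities. -/
structure Signature where
  Sym : Type
  arity : Sym → ℕ

/-- The variables `(n, k)`: `(n, 0)` is the `n`-th base variable, `(n, 1)` is its differential
variable, `(n, 2)` the differential variable of the latter, and so on. -/
abbrev Var : Type := ℕ × ℕ

/-- The differential variable `x'` of the variable `x`. -/
def Var.prime (v : Var) : Var := (v.1, v.2 + 1)

/-- Terms `x | c | e + e | e * e | h(e, …, e) | (e)'` with rational constants `c`. -/
inductive Term (S : Signature) : Type
  | var (v : Var) : Term S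
  | const (c : ℚ) : Term S
  | add (e₁ e₂ : Term S) : Term S
  | mul (e₁ e₂ : Term S) : Term S
  | app (h : S.Sym) (args : Fin (S.arity h) → Term S) : Term S
  | diff (e : Term S) : Term S

variable {S : Signature}

/-- Finite sums of terms. -/
def Term.sum : List (Term S) → Term S
  | [] => .const 0
  | e :: l => .add e (Term.sum l)

/-- A term that contains neither differentials `(e)'` nor differential variables `x'`. -/
def Term.DiffFree : Term S → Prop
  | .var v => v.2 = 0
  | .const _ => True
  | .add a b => a.DiffFree ∧ b.DiffFree
  | .mul a b => a.DiffFree ∧ b.DiffFree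
  | .app _ args => ∀ i, (args i).DiffFree
  | .diff _ => False

/-- A polynomial term. -/
def Term.IsPoly : Term S → Prop
  | .var _ => True
  | .const _ => True
  | .add a b => a.IsPoly ∧ b.IsPoly
  | .mul a b => a.IsPoly ∧ b.IsPoly
  | .app _ _ => False
  | .diff _ => False

/-- Free variables. The value of `(e)'` depends on the variables of `e` and on the associated
differential variables. -/
def Term.fv : Term S → Set Var
  | .var v => {v}
  | .const _ => ∅
  | .add a b => a.fv ∪ b.fv
  | .mul a b => a.fv ∪ b.fv
  | .app _ args => ⋃ i, (args i).fv
  | .diff e => e.fv ∪ Var.prime '' e.fv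

/-- Simultaneous substitution of terms for variables. It does not enter differentials; it is only
used under the admissibility condition `Term.SubstOK`. -/
def Term.subst (σ : Var → Term S) : Term S → Term S
  | .var v => σ v
  | .const c => .const c
  | .add a b => .add (a.subst σ) (b.subst σ)
  | .mul a b => .mul (a.subst σ) (b.subst σ)
  | .app h args => .app h fun i => (args i).subst σ
  | .diff e => .diff e

/-- `σ` is admissible: it replaces no free variable of a differential. -/
def Term.SubstOK (σ : Var → Term S) : Term S → Prop
  | .var _ => True
  | .const _ => True
  | .add a b => a.SubstOK σ ∧ b.SubstOK σ
  | .mul a b => a.SubstOK σ ∧ b.SubstOK σ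
  | .app _ args => ∀ i, (args i).SubstOK σ
  | .diff e => ∀ v ∈ (Term.diff e).fv, σ v = .var v

/-- The substitution of the single term `e` for the variable `x`. -/
def single (x : Var) (e : Term S) : Var → Term S := Function.update Term.var x e

/-- Propositional combinations of comparisons of terms (no quantifiers, no modalities). With
`SA.DiffFree` these are the semianalytic formulas. -/
inductive SA (S : Signature) : Type
  | eq (e₁ e₂ : Term S) : SA S
  | ge (e₁ e₂ : Term S) : SA S
  | gt (e₁ e₂ : Term S) : SA S
  | not (P : SA S) : SA S
  | and (P Q : SA S) : SA S
  | or (P Q : SA S) : SA S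

def SA.DiffFree : SA S → Prop
  | .eq a b => a.DiffFree ∧ b.DiffFree
  | .ge a b => a.DiffFree ∧ b.DiffFree
  | .gt a b => a.DiffFree ∧ b.DiffFree
  | .not P => P.DiffFree
  | .and P Q => P.DiffFree ∧ Q.DiffFree
  | .or P Q => P.DiffFree ∧ Q.DiffFree

def SA.fv : SA S → Set Var
  | .eq a b => a.fv ∪ b.fv
  | .ge a b => a.fv ∪ b.fv
  | .gt a b => a.fv ∪ b.fv
  | .not P => P.fv
  | .and P Q => P.fv ∪ Q.fv
  | .or P Q => P.fv ∪ Q.fv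

def SA.subst (σ : Var → Term S) : SA S → SA S
  | .eq a b => .eq (a.subst σ) (b.subst σ)
  | .ge a b => .ge (a.subst σ) (b.subst σ)
  | .gt a b => .gt (a.subst σ) (b.subst σ)
  | .not P => .not (P.subst σ)
  | .and P Q => .and (P.subst σ) (Q.subst σ)
  | .or P Q => .or (P.subst σ) (Q.subst σ)

def SA.SubstOK (σ : Var → Term S) : SA S → Prop
  | .eq a b => a.SubstOK σ ∧ b.SubstOK σ
  | .ge a b => a.SubstOK σ ∧ b.SubstOK σ
  | .gt a b => a.SubstOK σ ∧ b.SubstOK σ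
  | .not P => P.SubstOK σ
  | .and P Q => P.SubstOK σ ∧ Q.SubstOK σ
  | .or P Q => P.SubstOK σ ∧ Q.SubstOK σ

/-- A system `x₁' = f₁, …, xₙ' = fₙ`: the list of the pairs `(i, f)`, read as `(i, 0)' = f`. -/
abbrev ODE (S : Signature) : Type := List (ℕ × Term S)

/-- The indices of the evolving variables `x`. -/
def ODE.lhs (sys : ODE S) : List ℕ := sys.map Prod.fst

/-- An explicit-form system: distinct left-hand sides, differential-free right-hand sides. -/
def ODE.WF (sys : ODE S) : Prop := sys.lhs.Nodup ∧ ∀ p ∈ sys, p.2.DiffFree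

/-- The free variables of the right-hand sides. -/
def ODE.rhsFv (sys : ODE S) : Set Var := {v | ∃ p ∈ sys, v ∈ p.2.fv}

/-- The bound variables `x, x'` of a system. -/
def ODE.bv (sys : ODE S) : Set Var := {v | v.1 ∈ sys.lhs ∧ v.2 ≤ 1}

/-- Programs: `x' = f(x) & Q`, and the assignment `x := e`. -/
inductive Prog (S : Signature) : Type
  | ode (sys : ODE S) (Q : SA S) : Prog S
  | assign (x : Var) (e : Term S) : Prog S

/-- Bound variables. -/
def Prog.bv : Prog S → Set Var
  | .ode sys _ => sys.bv
  | .assign x _ => {x}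

/-- Free variables. -/
def Prog.fv : Prog S → Set Var
  | .ode sys Q => {v | v.1 ∈ sys.lhs ∧ v.2 = 0} ∪ sys.rhsFv ∪ Q.fv
  | .assign _ e => e.fv

open Classical in
/-- The substitution that remains in the scope of the variables in `B`. -/
def shield (B : Set Var) (σ : Var → Term S) : Var → Term S :=
  fun v => if v ∈ B then .var v else σ v

def Prog.subst (σ : Var → Term S) : Prog S → Prog S
  | .ode sys Q => .ode (sys.map fun p => (p.1, p.2.subst (shield sys.bv σ)))
      (Q.subst (shield sys.bv σ))
  | .assign x e => .assign x (e.subst σ)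

/-- Admissibility for programs: evolving variables are not replaced, and no variable of a
replacement is captured. -/
def Prog.SubstOK (σ : Var → Term S) : Prog S → Prop
  | .ode sys Q => (∀ i ∈ sys.lhs, σ (i, 0) = .var (i, 0)) ∧
      (∀ v ∈ sys.rhsFv ∪ Q.fv, v ∉ sys.bv → Disjoint (σ v).fv sys.bv) ∧
      (∀ p ∈ sys, p.2.SubstOK (shield sys.bv σ)) ∧ Q.SubstOK (shield sys.bv σ)
  | .assign _ e => e.SubstOK σ

/-- Formulas. -/
inductive Fml (S : Signature) : Type
  | eq (e₁ e₂ : Term S) : Fml S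
  | ge (e₁ e₂ : Term S) : Fml S
  | gt (e₁ e₂ : Term S) : Fml S
  | not (φ : Fml S) : Fml S
  | and (φ ψ : Fml S) : Fml S
  | or (φ ψ : Fml S) : Fml S
  | all (x : Var) (φ : Fml S) : Fml S
  | ex (x : Var) (φ : Fml S) : Fml S
  | box (α : Prog S) (φ : Fml S) : Fml S
  | dia (α : Prog S) (φ : Fml S) : Fml S

/-- Semianalytic formulas are formulas. -/
def SA.toFml : SA S → Fml S
  | .eq a b => .eq a b
  | .ge a b => .ge a b
  | .gt a b => .gt a b
  | .not P => .not P.toFml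
  | .and P Q => .and P.toFml Q.toFml
  | .or P Q => .or P.toFml Q.toFml

namespace Fml

def imp (φ ψ : Fml S) : Fml S := .or (.not φ) ψ
def iff (φ ψ : Fml S) : Fml S := .and (imp φ ψ) (imp ψ φ)
def tru : Fml S := .eq (.const 0) (.const 0)
def fls : Fml S := .eq (.const 0) (.const 1)

/-- Finite conjunctions. -/
def conj : List (Fml S) → Fml S
  | [] => tru
  | [φ] => φ
  | φ :: ψ :: l => .and φ (conj (ψ :: l))

/-- Finite disjunctions. -/
def disj : List (Fml S) → Fml S
  | [] => fls
  | [φ] => φ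
  | φ :: ψ :: l => .or φ (disj (ψ :: l))

/-- `x = y` for vectors of base variables. -/
def vecEq (xs ys : List ℕ) : Fml S :=
  conj (List.zipWith (fun i j => .eq (.var (i, 0)) (.var (j, 0))) xs ys)

/-- Free variables. -/
def fv : Fml S → Set Var
  | .eq a b => a.fv ∪ b.fv
  | .ge a b => a.fv ∪ b.fv
  | .gt a b => a.fv ∪ b.fv
  | .not φ => φ.fv
  | .and φ ψ => φ.fv ∪ ψ.fv
  | .or φ ψ => φ.fv ∪ ψ.fv
  | .all x φ => φ.fv \ {x}
  | .ex x φ => φ.fv \ {x}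
  | .box α φ => α.fv ∪ (φ.fv \ α.bv)
  | .dia α φ => α.fv ∪ (φ.fv \ α.bv)

def subst : (Var → Term S) → Fml S → Fml S
  | σ, .eq a b => .eq (a.subst σ) (b.subst σ)
  | σ, .ge a b => .ge (a.subst σ) (b.subst σ)
  | σ, .gt a b => .gt (a.subst σ) (b.subst σ)
  | σ, .not φ => .not (φ.subst σ)
  | σ, .and φ ψ => .and (φ.subst σ) (ψ.subst σ)
  | σ, .or φ ψ => .or (φ.subst σ) (ψ.subst σ)
  | σ, .all x φ => .all x (φ.subst (shield {x} σ))
  | σ, .ex x φ => .ex x (φ.subst (shield {x} σ))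
  | σ, .box α φ => .box (α.subst σ) (φ.subst (shield α.bv σ))
  | σ, .dia α φ => .dia (α.subst σ) (φ.subst (shield α.bv σ))

/-- Admissibility: the replaced variables are free for their replacements (no capture). -/
def SubstOK : (Var → Term S) → Fml S → Prop
  | σ, .eq a b => a.SubstOK σ ∧ b.SubstOK σ
  | σ, .ge a b => a.SubstOK σ ∧ b.SubstOK σ
  | σ, .gt a b => a.SubstOK σ ∧ b.SubstOK σ
  | σ, .not φ => φ.SubstOK σ
  | σ, .and φ ψ => φ.SubstOK σ ∧ ψ.SubstOK σ
  | σ, .or φ ψ => φ.SubstOK σ ∧ ψ.SubstOK σ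
  | σ, .all x φ => (∀ v ∈ φ.fv, v ≠ x → x ∉ (σ v).fv) ∧ φ.SubstOK (shield {x} σ)
  | σ, .ex x φ => (∀ v ∈ φ.fv, v ≠ x → x ∉ (σ v).fv) ∧ φ.SubstOK (shield {x} σ)
  | σ, .box α φ => α.SubstOK σ ∧ (∀ v ∈ φ.fv, v ∉ α.bv → Disjoint (σ v).fv α.bv) ∧
      φ.SubstOK (shield α.bv σ)
  | σ, .dia α φ => α.SubstOK σ ∧ (∀ v ∈ φ.fv, v ∉ α.bv → Disjoint (σ v).fv α.bv) ∧
      φ.SubstOK (shield α.bv σ)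

/-- Formulas of first-order real arithmetic: polynomial comparisons, connectives, quantifiers. -/
def IsArith : Fml S → Prop
  | .eq a b => a.IsPoly ∧ b.IsPoly
  | .ge a b => a.IsPoly ∧ b.IsPoly
  | .gt a b => a.IsPoly ∧ b.IsPoly
  | .not φ => φ.IsArith
  | .and φ ψ => φ.IsArith ∧ ψ.IsArith
  | .or φ ψ => φ.IsArith ∧ ψ.IsArith
  | .all _ φ => φ.IsArith
  | .ex _ φ => φ.IsArith
  | .box _ _ => False
  | .dia _ _ => False

end Fml

/-! ## Semantics -/

abbrev State : Type := Var → ℝ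

/-- Interpretations of the fixed function symbols. -/
abbrev Interp (S : Signature) : Type := (h : S.Sym) → (Fin (S.arity h) → ℝ) → ℝ

/-- The value of a term; `(e)'` has the value `∑ₓ ω(x') ∂e/∂x` (finitely many nonzero summands). -/
def Term.sem (I : Interp S) : Term S → State → ℝ
  | .var v, ω => ω v
  | .const c, _ => (c : ℝ)
  | .add a b, ω => a.sem I ω + b.sem I ω
  | .mul a b, ω => a.sem I ω * b.sem I ω
  | .app h args, ω => I h fun i => (args i).sem I ω
  | .diff e, ω =>
      ∑ᶠ x : Var, ω x.prime * deriv (fun r : ℝ => e.sem I (Function.update ω x r)) (ω x)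

def SA.Sat (I : Interp S) (ω : State) : SA S → Prop
  | .eq a b => a.sem I ω = b.sem I ω
  | .ge a b => b.sem I ω ≤ a.sem I ω
  | .gt a b => b.sem I ω < a.sem I ω
  | .not P => ¬ P.Sat I ω
  | .and P Q => P.Sat I ω ∧ Q.Sat I ω
  | .or P Q => P.Sat I ω ∨ Q.Sat I ω

/-- `φ` is a solution on `[0, T]` of the system that stays in the domain `Q`. -/
def ODE.IsSol (I : Interp S) (sys : ODE S) (Q : SA S) (T : ℝ) (φ : ℝ → State) : Prop :=
  ∀ t ∈ Set.Icc 0 T,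
    (∀ p ∈ sys, φ t (p.1, 1) = p.2.sem I (φ t)) ∧ Q.Sat I (φ t) ∧
    (∀ v, v ∉ sys.bv → φ t v = φ 0 v) ∧
    (0 < T → ∀ i ∈ sys.lhs,
      HasDerivWithinAt (fun s => φ s (i, 0)) (φ t (i, 1)) (Set.Icc 0 T) t)

/-- The transition relation of a program. -/
def Prog.Rel (I : Interp S) : Prog S → State → State → Prop
  | .ode sys Q, ω, ν => ∃ T : ℝ, 0 ≤ T ∧ ∃ φ : ℝ → State,
      (∀ v : Var, ¬ (v.1 ∈ sys.lhs ∧ v.2 = 1) → φ 0 v = ω v) ∧ φ T = ν ∧ sys.IsSol I Q T φ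
  | .assign x e, ω, ν => ν = Function.update ω x (e.sem I ω)

/-- Truth of a formula in a state. -/
def Fml.Sat (I : Interp S) : Fml S → State → Prop
  | .eq a b, ω => a.sem I ω = b.sem I ω
  | .ge a b, ω => b.sem I ω ≤ a.sem I ω
  | .gt a b, ω => b.sem I ω < a.sem I ω
  | .not φ, ω => ¬ φ.Sat I ω
  | .and φ ψ, ω => φ.Sat I ω ∧ ψ.Sat I ω
  | .or φ ψ, ω => φ.Sat I ω ∨ ψ.Sat I ω
  | .all x φ, ω => ∀ r : ℝ, φ.Sat I (Function.update ω x r)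
  | .ex x φ, ω => ∃ r : ℝ, φ.Sat I (Function.update ω x r)
  | .box α φ, ω => ∀ ν, α.Rel I ω ν → φ.Sat I ν
  | .dia α φ, ω => ∃ ν, α.Rel I ω ν ∧ φ.Sat I ν

/-- Truth in all states. -/
def Fml.Valid (I : Interp S) (φ : Fml S) : Prop := ∀ ω, φ.Sat I ω

/-! ## Extended term languages and Lie derivatives -/

/-- Syntactic application `t(e₁, …, eₖ)`: replace the variable `(j, 0)` by `eⱼ` for `j < k`. -/
def Term.inst {k : ℕ} (t : Term S) (args : Fin k → Term S) : Term S :=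
  t.subst fun v => if hv : v.1 < k ∧ v.2 = 0 then args ⟨v.1, hv.1⟩ else .var v

/-- An extended term language: the function symbols are interpreted by smooth functions, and their
partial derivatives are represented by terms `pd h i` in the variables `(0, 0), …, (k - 1, 0)`. -/
structure ExtLang (S : Signature) where
  interp : Interp S
  smooth : ∀ h, ContDiff ℝ ((⊤ : ℕ∞) : WithTop ℕ∞) (interp h)
  pd : (h : S.Sym) → Fin (S.arity h) → Term S
  pd_diffFree : ∀ h i, (pd h i).DiffFree
  pd_fv : ∀ h i, ∀ v ∈ (pd h i).fv, v.1 < S.arity h ∧ v.2 = 0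
  pd_sem : ∀ h i (ω : State), (pd h i).sem interp ω =
    deriv (fun r : ℝ => interp h (Function.update (fun j => ω ((j : ℕ), 0)) i r)) (ω ((i : ℕ), 0))

/-- The right-hand side of the equation for the variable `v`, and `0` if `v` does not evolve. -/
def ODE.field (sys : ODE S) (v : Var) : Term S :=
  match sys.find? (fun p => p.1 = v.1) with
  | some p => if v.2 = 0 then p.2 else .const 0
  | none => .const 0

/-- The Lie derivative of a differential-free term along the system: the term that results from
rewriting `(e)'` with the differential axioms and replacing `xᵢ'` by `fᵢ`.
(The last clause is never used for differential-free terms.) -/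
def lie (L : ExtLang S) (sys : ODE S) : Term S → Term S
  | .var v => sys.field v
  | .const _ => .const 0
  | .add a b => .add (lie L sys a) (lie L sys b)
  | .mul a b => .add (.mul (lie L sys a) b) (.mul a (lie L sys b))
  | .app h args =>
      Term.sum (List.ofFn fun i => .mul ((L.pd h i).inst args) (lie L sys (args i)))
  | .diff _ => .const 0

/-- Higher Lie derivatives. -/
def lieIter (L : ExtLang S) (sys : ODE S) (i : ℕ) (e : Term S) : Term S := (lie L sys)^[i] e

/-- The system has no point at which its right-hand side is the zero vector. -/
def ODE.LocallyEvolves (L : ExtLang S) (sys : ODE S) : Prop :=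
  ∀ ω : State, ∃ p ∈ sys, p.2.sem L.interp ω ≠ 0

/-! ## The proof calculus -/

/-- `[x₁' := f₁] … [xₙ' := fₙ] φ`. -/
def assignField : ODE S → Fml S → Fml S
  | [], φ => φ
  | p :: sys, φ => .box (.assign (p.1, 1) p.2) (assignField sys φ)

/-- `[z₁' := 0] … [zₘ' := 0] φ`. -/
def assignZero : List ℕ → Fml S → Fml S
  | [], φ => φ
  | z :: zs, φ => .box (.assign (z, 1) (.const 0)) (assignZero zs φ)

/-- `zs` lists (at least) the variables of `e` that do not evolve, the parameters of the
differential-free term `e`. Parameters do not change along the system, so their differential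
variables are set to `0` where `(e)'` is evaluated. Without parameters, `assignZero [] φ` is `φ`. -/
def ParamsOf (sys : ODE S) (e : Term S) (zs : List ℕ) : Prop :=
  (∀ z ∈ zs, z ∉ sys.lhs) ∧ ∀ v ∈ e.fv, v.1 ∈ sys.lhs ∨ v.1 ∈ zs

/-- `Derivable L Γ φ`: the sequent `Γ ⊢ φ` is derivable from the base calculus together with the
axioms `Cont` and `Uniq`. (Differential adjoints and real induction are not included.) -/
inductive Derivable (L : ExtLang S) : List (Fml S) → Fml S → Prop
  -- classical propositional logic
  | id {Γ φ} : φ ∈ Γ → Derivable L Γ φ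
  | weaken {Γ Δ φ} : Γ ⊆ Δ → Derivable L Γ φ → Derivable L Δ φ
  | cut {Γ φ ψ} : Derivable L Γ ψ → Derivable L (ψ :: Γ) φ → Derivable L Γ φ
  | notL {Γ : List (Fml S)} {φ : Fml S} : Derivable L Γ φ → Derivable L (.not φ :: Γ) .fls
  | notR {Γ φ} : Derivable L (φ :: Γ) .fls → Derivable L Γ (.not φ)
  | classical {Γ φ} : Derivable L (.not φ :: Γ) .fls → Derivable L Γ φ
  | andL {Γ φ₁ φ₂ ψ} : Derivable L (φ₁ :: φ₂ :: Γ) ψ → Derivable L (.and φ₁ φ₂ :: Γ) ψ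
  | andR {Γ φ₁ φ₂} : Derivable L Γ φ₁ → Derivable L Γ φ₂ → Derivable L Γ (.and φ₁ φ₂)
  | orL {Γ φ₁ φ₂ ψ} : Derivable L (φ₁ :: Γ) ψ → Derivable L (φ₂ :: Γ) ψ →
      Derivable L (.or φ₁ φ₂ :: Γ) ψ
  | orR₁ {Γ φ₁ φ₂} : Derivable L Γ φ₁ → Derivable L Γ (.or φ₁ φ₂)
  | orR₂ {Γ φ₁ φ₂} : Derivable L Γ φ₂ → Derivable L Γ (.or φ₁ φ₂)
  | impL {Γ φ₁ φ₂ ψ} : Derivable L Γ φ₁ → Derivable L (φ₂ :: Γ) ψ →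
      Derivable L (.imp φ₁ φ₂ :: Γ) ψ
  | impR {Γ φ₁ φ₂} : Derivable L (φ₁ :: Γ) φ₂ → Derivable L Γ (.imp φ₁ φ₂)
  -- quantifiers and equality
  | allL {Γ : List (Fml S)} {x : Var} {φ : Fml S} {e : Term S} {ψ : Fml S} : φ.SubstOK (single x e) → Derivable L (φ.subst (single x e) :: Γ) ψ →
      Derivable L (.all x φ :: Γ) ψ
  | allR {Γ : List (Fml S)} {x : Var} {φ : Fml S} {y : Var} : φ.SubstOK (single x (.var y)) → (∀ χ ∈ Γ, y ∉ χ.fv) →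
      y ∉ (Fml.all x φ).fv → Derivable L Γ (φ.subst (single x (.var y))) →
      Derivable L Γ (.all x φ)
  | exL {Γ : List (Fml S)} {x : Var} {φ : Fml S} {y : Var} {ψ : Fml S} : φ.SubstOK (single x (.var y)) → (∀ χ ∈ Γ, y ∉ χ.fv) →
      y ∉ (Fml.ex x φ).fv → y ∉ ψ.fv →
      Derivable L (φ.subst (single x (.var y)) :: Γ) ψ → Derivable L (.ex x φ :: Γ) ψ
  | exR {Γ : List (Fml S)} {x : Var} {φ : Fml S} {e : Term S} : φ.SubstOK (single x e) → Derivable L Γ (φ.subst (single x e)) →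
      Derivable L Γ (.ex x φ)
  | eqSubst {Γ : List (Fml S)} {x : Var} {φ : Fml S} {e₁ e₂ : Term S} : φ.SubstOK (single x e₁) → φ.SubstOK (single x e₂) →
      Derivable L Γ (.imp (.eq e₁ e₂)
        (.imp (φ.subst (single x e₁)) (φ.subst (single x e₂))))
  -- substitution instances of valid formulas of first-order real arithmetic
  | arith {Γ : List (Fml S)} {ψ : Fml S} {σ : Var → Term S} : ψ.IsArith → ψ.Valid L.interp → ψ.SubstOK σ → Derivable L Γ (ψ.subst σ)
  -- programs
  | assign {Γ : List (Fml S)} {x : Var} {e : Term S} {φ : Fml S} : φ.SubstOK (single x e) →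
      Derivable L Γ (.iff (.box (.assign x e) φ) (φ.subst (single x e)))
  | diamond {Γ α φ} : Derivable L Γ (.iff (.dia α φ) (.not (.box α (.not φ))))
  | K {Γ α φ ψ} : Derivable L Γ (.imp (.box α (.imp φ ψ)) (.imp (.box α φ) (.box α ψ)))
  | G {Γ α φ} : Derivable L [] φ → Derivable L Γ (.box α φ)
  | V {Γ : List (Fml S)} {α : Prog S} {φ : Fml S} : Disjoint φ.fv α.bv → Derivable L Γ (.imp φ (.box α φ))
  -- differentials
  | diffConst {Γ c} : Derivable L Γ (.eq (.diff (.const c)) (.const 0))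
  | diffVar {Γ v} : Derivable L Γ (.eq (.diff (.var v)) (.var v.prime))
  | diffAdd {Γ a b} : Derivable L Γ (.eq (.diff (.add a b)) (.add (.diff a) (.diff b)))
  | diffMul {Γ a b} : Derivable L Γ
      (.eq (.diff (.mul a b)) (.add (.mul (.diff a) b) (.mul a (.diff b))))
  | diffApp {Γ h args} : Derivable L Γ (.eq (.diff (.app h args))
      (Term.sum (List.ofFn fun i => .mul ((L.pd h i).inst args) (.diff (args i)))))
  -- differential equations
  | DE {Γ sys Q P} : ODE.WF sys → SA.DiffFree Q →
      Derivable L Γ (.iff (.box (.ode sys Q) P) (.box (.ode sys Q) (assignField sys P)))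
  | DW {Γ sys Q} : ODE.WF sys → SA.DiffFree Q →
      Derivable L Γ (.box (.ode sys Q) Q.toFml)
  | DX {Γ sys Q P} : ODE.WF sys → SA.DiffFree Q → (∀ i ∈ sys.lhs, (i, 1) ∉ P.fv) →
      Derivable L Γ (.iff (.box (.ode sys Q) P)
        (.imp Q.toFml (.and P (.box (.ode sys Q) P))))
  | DMP {Γ sys Q R P} : ODE.WF sys → SA.DiffFree Q → SA.DiffFree R →
      Derivable L Γ (.imp (.box (.ode sys Q) (.imp Q.toFml R.toFml))
        (.imp (.box (.ode sys R) P) (.box (.ode sys Q) P)))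
  | barcan {Γ sys Q y P} : ODE.WF sys → SA.DiffFree Q → y ∉ sys.bv → y ∉ sys.rhsFv →
      y ∉ Q.fv → Derivable L Γ
        (.iff (.dia (.ode sys Q) (.ex y P)) (.ex y (.dia (.ode sys Q) P)))
  | DIeq {Γ sys Q e zs} : ODE.WF sys → SA.DiffFree Q → Term.DiffFree e → ParamsOf sys e zs →
      Derivable L Γ (.imp (.box (.ode sys Q) (assignZero zs (.eq (.diff e) (.const 0))))
        (.iff (.box (.ode sys Q) (.eq e (.const 0))) (.imp Q.toFml (.eq e (.const 0)))))
  | DIge {Γ sys Q e zs} : ODE.WF sys → SA.DiffFree Q → Term.DiffFree e → ParamsOf sys e zs →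
      Derivable L Γ (.imp (.box (.ode sys Q) (assignZero zs (.ge (.diff e) (.const 0))))
        (.iff (.box (.ode sys Q) (.ge e (.const 0))) (.imp Q.toFml (.ge e (.const 0)))))
  | DIgt {Γ sys Q e zs} : ODE.WF sys → SA.DiffFree Q → Term.DiffFree e → ParamsOf sys e zs →
      Derivable L Γ (.imp (.box (.ode sys Q) (assignZero zs (.ge (.diff e) (.const 0))))
        (.iff (.box (.ode sys Q) (.gt e (.const 0))) (.imp Q.toFml (.gt e (.const 0)))))
  | DC {Γ sys Q R P} : ODE.WF sys → SA.DiffFree Q → SA.DiffFree R →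
      Derivable L Γ (.imp (.box (.ode sys Q) R.toFml)
        (.iff (.box (.ode sys Q) P) (.box (.ode sys (.and Q R)) P)))
  | DGex {Γ sys Q P y a b} : ODE.WF sys → SA.DiffFree Q → Term.DiffFree a → Term.DiffFree b →
      y ∉ sys.lhs → (y, 0) ∉ sys.rhsFv ∪ Q.fv ∪ a.fv ∪ b.fv ∪ P.fv → (y, 1) ∉ P.fv →
      Derivable L Γ (.iff (.box (.ode sys Q) P)
        (.ex (y, 0) (.box (.ode (sys ++ [(y, .add (.mul a (.var (y, 0))) b)]) Q) P)))
  | DGall {Γ sys Q P y a b} : ODE.WF sys → SA.DiffFree Q → Term.DiffFree a → Term.DiffFree b →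
      y ∉ sys.lhs → (y, 0) ∉ sys.rhsFv ∪ Q.fv ∪ a.fv ∪ b.fv ∪ P.fv → (y, 1) ∉ P.fv →
      Derivable L Γ (.iff (.box (.ode sys Q) P)
        (.all (y, 0) (.box (.ode (sys ++ [(y, .add (.mul a (.var (y, 0))) b)]) Q) P)))
  -- uniqueness and continuous existence
  | Uniq {Γ sys Q₁ Q₂ P} : ODE.WF sys → SA.DiffFree Q₁ → SA.DiffFree Q₂ →
      Derivable L Γ (.iff (.dia (.ode sys (.and Q₁ Q₂)) P)
        (.and (.dia (.ode sys Q₁) P) (.dia (.ode sys Q₂) P)))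
  | Cont {Γ sys e ys} : ODE.WF sys → sys.LocallyEvolves L → Term.DiffFree e →
      ys.length = sys.lhs.length → ys.Nodup →
      (∀ y ∈ ys, y ∉ sys.lhs ∧ (y, 0) ∉ sys.rhsFv ∪ e.fv) →
      Derivable L Γ (.imp (.vecEq sys.lhs ys)
        (.iff (.dia (.ode sys (.gt e (.const 0))) (.not (.vecEq sys.lhs ys)))
          (.gt e (.const 0))))

/-! ## Differential radicals and progress formulas -/

/-- Differential radicals: every differential-free term `e` has, along every system, a rank `N ≥ 1`
and cofactors `g₀, …, g_(N-1)` such that the `N`-th Lie derivative of `e` is provably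
`∑ gᵢ · (i-th Lie derivative of e)`. -/
structure DiffRadicals (L : ExtLang S) where
  rank : ODE S → Term S → ℕ
  cof : ODE S → Term S → ℕ → Term S
  rank_pos : ∀ sys e, sys.WF → e.DiffFree → 1 ≤ rank sys e
  cof_diffFree : ∀ sys e i, sys.WF → e.DiffFree → i < rank sys e → (cof sys e i).DiffFree
  identity : ∀ sys e, sys.WF → e.DiffFree →
    Derivable L [] (.eq (lieIter L sys (rank sys e) e)
      (Term.sum ((List.range (rank sys e)).map
        fun i => .mul (cof sys e i) (lieIter L sys i e))))

/-- The conjunction of the equations "`i`-th Lie derivative of `e` is zero", for `i < N`. -/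
def lieZeros (L : ExtLang S) (sys : ODE S) (N : ℕ) (e : Term S) : Fml S :=
  .conj ((List.range N).map fun i => .eq (lieIter L sys i e) (.const 0))

variable {L : ExtLang S}

/-- The differential radical formula of `e`. -/
def DiffRadicals.radical (R : DiffRadicals L) (sys : ODE S) (e : Term S) : Fml S :=
  lieZeros L sys (R.rank sys e) e

/-- The progress formula for `e > 0`: the conjunction over `i < N` of
"if all Lie derivatives of order `< i` vanish, then the one of order `i` is `≥ 0`",
where `≥` is replaced by `>` for the last index `i = N - 1`. -/
def DiffRadicals.progressGt (R : DiffRadicals L) (sys : ODE S) (e : Term S) : Fml S :=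
  .conj ((List.range (R.rank sys e)).map fun i =>
    let c : Fml S := if i + 1 < R.rank sys e then .ge (lieIter L sys i e) (.const 0)
      else .gt (lieIter L sys i e) (.const 0)
    if i = 0 then c else .imp (lieZeros L sys i e) c)

/-- The progress formula for `e ≥ 0`. -/
def DiffRadicals.progressGe (R : DiffRadicals L) (sys : ODE S) (e : Term S) : Fml S :=
  .or (R.progressGt sys e) (R.radical sys e)

/-- Normal forms `⋁ᵢ (⋀ⱼ eᵢⱼ ≥ 0 ∧ ⋀ⱼ dᵢⱼ > 0)`: the list over `i` of the pairs of lists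
`(eᵢⱼ)ⱼ` and `(dᵢⱼ)ⱼ`. -/
abbrev NF (S : Signature) : Type := List (List (Term S) × List (Term S))

def NF.DiffFree (D : NF S) : Prop := ∀ c ∈ D, (∀ e ∈ c.1, e.DiffFree) ∧ ∀ e ∈ c.2, e.DiffFree

def NF.toFml (D : NF S) : Fml S :=
  .disj (D.map fun c => .and (.conj (c.1.map fun e => .ge e (.const 0)))
    (.conj (c.2.map fun e => .gt e (.const 0))))

/-- `D` is a normal form of `Q`: the two are provably equivalent. -/
def NF.IsNormalFormOf (L : ExtLang S) (D : NF S) (Q : SA S) : Prop :=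
  D.DiffFree ∧ Derivable L [] (.iff Q.toFml D.toFml)

/-- The semianalytic progress formula of a formula in normal form. -/
def DiffRadicals.progress (R : DiffRadicals L) (sys : ODE S) (D : NF S) : Fml S :=
  .disj (D.map fun c => .and (.conj (c.1.map (R.progressGe sys)))
    (.conj (c.2.map (R.progressGt sys))))

end DL

end

noncomputable section

namespace DL

variable {S : Signature} {L : ExtLang S}

/-! Derivability is tested in maximal consistent sets of formulas ("worlds"), as in the canonical
model of a modal logic. A formula that lies in every world is derivable
(`derivable_of_forall_world`), and a box formula lies in a world iff its postcondition lies in all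
accessible worlds (`World.mem_box`). Since all instances of real arithmetic are provable, terms
modulo equality in a world form a linearly ordered commutative ring `World.Val`. Long sequent
derivations thus become inequalities in ordered rings, and the axioms for differential equations
become rules about worlds. Solutions of differential equations are never used.

Two facts carry the theorem. Invariance (`World.box_eq_of_radical`): if all Lie derivatives of `e`
below the rank vanish, they stay zero. By the radical identity their sum of squares `s` satisfies
`s' ≤ g s` for some term `g`, and a Darboux argument with two scalar ghosts
(`World.box_ge_of_darboux`) keeps `-s ≥ 0`.

Local progress (`World.sustains_pos`): adjoin a fresh clock `t' = 1` with `t = 0` now. The system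
then has no zero, so `Cont` applies, and "the state has left its initial value" can be replaced by
`t ≠ 0`. If the first nonvanishing Lie derivative of `e` is positive and has order `m`, then the
inequality `e ≥ t^(m+1)/(m+1)!` can be maintained until the clock has moved. `Uniq` intersects
finitely many such domains. Hence after the clock moves, the signs of all relevant terms are decided
by their progress and radical formulas.

Now let `Q` hold initially. If `Prog(Q)` holds, `Q` can be followed until the clock moves
(`ClockExtension.radical_mem`); were `Rad(e)` false, `e` would be nonzero there, so safety forces
`Rad(e)`, and conversely `Rad(e)` gives safety by invariance. If `Prog(Q)` fails, every disjunct of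
the normal form breaks as soon as the clock moves (`ClockExtension.box_mem`), so along `Q` the clock
stays at `0`, every term that is zero keeps this value, and `e = 0` initially suffices. -/

/-! ## Maximal consistent sets of formulas -/

/-- No finite part of `T` is contradictory. -/
def Consistent (L : ExtLang S) (T : Set (Fml S)) : Prop :=
  ∀ Γ : List (Fml S), (∀ φ ∈ Γ, φ ∈ T) → ¬ Derivable L Γ .fls

/-- Maximal consistent sets of formulas. -/
structure World (L : ExtLang S) where
  carrier : Set (Fml S)
  consistent : Consistent L carrier
  complete : ∀ φ, φ ∈ carrier ∨ Fml.not φ ∈ carrier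

instance : Membership (Fml S) (World L) := ⟨fun W φ => φ ∈ W.carrier⟩

theorem Derivable.absurd {Γ : List (Fml S)} {φ : Fml S} (h : Derivable L Γ φ)
    (h' : Derivable L Γ (.not φ)) : Derivable L Γ .fls :=
  .cut h' (.notL h)

/-- Lindenbaum's lemma by Zorn: a contradiction uses finitely many formulas, so unions of chains
stay consistent. -/
theorem Consistent.exists_world {T : Set (Fml S)} (hT : Consistent L T) :
    ∃ W : World L, ∀ φ ∈ T, φ ∈ W := by
  classical
  obtain ⟨M, hTM, hM⟩ := zorn_subset_nonempty {T | Consistent L T} (by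
    intro c hc hchain hne
    refine ⟨⋃₀ c, ?_, fun s hs => Set.subset_sUnion_of_mem hs⟩
    intro Γ hΓ hd
    have key : ∀ Γ : List (Fml S), (∀ φ ∈ Γ, φ ∈ ⋃₀ c) → ∃ s ∈ c, ∀ φ ∈ Γ, φ ∈ s := by
      intro Γ
      induction Γ with
      | nil => intro _; obtain ⟨s, hs⟩ := hne; exact ⟨s, hs, by simp⟩
      | cons φ Γ ih =>
        intro h
        obtain ⟨s, hs, h1⟩ := ih fun ψ hψ => h ψ (by simp [hψ])
        obtain ⟨s', hs', h2⟩ := h φ (by simp)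
        rcases hchain.total hs hs' with hh | hh
        · exact ⟨s', hs', by simpa [h2] using fun ψ hψ => hh (h1 ψ hψ)⟩
        · exact ⟨s, hs, by simpa [hh h2] using h1⟩
    obtain ⟨s, hs, h⟩ := key Γ hΓ
    exact hc hs Γ h hd) T hT
  have hcons : Consistent L M := hM.prop
  -- By maximality, a formula outside `M` is refuted by finitely many members of `M`. If both `φ`
  -- and its negation were outside, the two refutations would combine into an inconsistency of `M`.
  have step : ∀ φ, φ ∉ M → ∃ Γ : List (Fml S), (∀ ψ ∈ Γ, ψ ∈ M) ∧ Derivable L (φ :: Γ) .fls := by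
    intro φ hφ
    by_contra hcon
    push Not at hcon
    have hins : Consistent L (insert φ M) := by
      intro Γ hΓ hd
      refine hcon (Γ.filter (· ≠ φ)) ?_ (hd.weaken ?_)
      · intro ψ hψ
        rw [List.mem_filter] at hψ
        rcases hΓ ψ hψ.1 with rfl | h
        · simp at hψ
        · exact h
      · intro ψ hψ
        by_cases h : ψ = φ <;> simp [h, hψ]
    exact hφ (hM.le_of_ge hins (Set.subset_insert φ M) (Set.mem_insert φ M))
  refine ⟨⟨M, hcons, fun φ => ?_⟩, fun φ hφ => hTM hφ⟩
  by_contra hcon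
  push Not at hcon
  obtain ⟨Γ, hΓ, h1⟩ := step _ hcon.1
  obtain ⟨Δ, hΔ, h2⟩ := step _ hcon.2
  refine hcons (Γ ++ Δ) (by
    intro φ hφ
    rcases List.mem_append.1 hφ with h | h
    exacts [hΓ φ h, hΔ φ h]) ?_
  exact (h2.classical.weaken (by simp)).absurd (h1.notR.weaken (by simp))

namespace World

theorem mem_of_derivable (W : World L) {Γ : List (Fml S)} {φ : Fml S} (h : Derivable L Γ φ)
    (hΓ : ∀ ψ ∈ Γ, ψ ∈ W) : φ ∈ W := by
  refine (W.complete φ).resolve_right fun hn => W.consistent (.not φ :: Γ) ?_ (.notL h)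
  simpa using ⟨hn, hΓ⟩

theorem mem_of_provable (W : World L) {φ : Fml S} (h : Derivable L [] φ) : φ ∈ W :=
  W.mem_of_derivable h (by simp)

theorem fls_notMem (W : World L) : Fml.fls ∉ W := fun h =>
  W.consistent [.fls] (by rintro φ hφ; rw [List.mem_singleton.1 hφ]; exact h) (.id (by simp))

@[simp] theorem mem_not (W : World L) {φ : Fml S} : Fml.not φ ∈ W ↔ φ ∉ W := by
  refine ⟨fun h h' => W.fls_notMem (W.mem_of_derivable (Γ := [.not φ, φ])
    (.notL (.id (by simp))) (by simp [h, h'])), (W.complete φ).resolve_left⟩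

@[simp] theorem mem_and (W : World L) {φ ψ : Fml S} : Fml.and φ ψ ∈ W ↔ φ ∈ W ∧ ψ ∈ W := by
  refine ⟨fun h => ⟨?_, ?_⟩, fun h => ?_⟩
  · exact W.mem_of_derivable (Γ := [.and φ ψ]) (.andL (.id (by simp))) (by simpa using h)
  · exact W.mem_of_derivable (Γ := [.and φ ψ]) (.andL (.id (by simp))) (by simpa using h)
  · exact W.mem_of_derivable (Γ := [φ, ψ]) (.andR (.id (by simp)) (.id (by simp))) (by simpa using h)

@[simp] theorem mem_or (W : World L) {φ ψ : Fml S} : Fml.or φ ψ ∈ W ↔ φ ∈ W ∨ ψ ∈ W := by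
  refine ⟨fun h => ?_, fun h => ?_⟩
  · by_contra hcon
    push Not at hcon
    rw [← mem_not, ← mem_not] at hcon
    refine W.fls_notMem (W.mem_of_derivable (Γ := [.or φ ψ, .not φ, .not ψ]) (.orL ?_ ?_)
      (by simpa using ⟨h, by simpa using hcon⟩))
    · exact .absurd (.id (φ := φ) (by simp)) (.id (by simp))
    · exact .absurd (.id (φ := ψ) (by simp)) (.id (by simp))
  · rcases h with h | h
    · exact W.mem_of_derivable (Γ := [φ]) (.orR₁ (.id (by simp))) (by simpa using h)
    · exact W.mem_of_derivable (Γ := [ψ]) (.orR₂ (.id (by simp))) (by simpa using h)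

@[simp] theorem mem_imp (W : World L) {φ ψ : Fml S} : Fml.imp φ ψ ∈ W ↔ (φ ∈ W → ψ ∈ W) := by
  simp [Fml.imp, imp_iff_not_or]

@[simp] theorem mem_iff (W : World L) {φ ψ : Fml S} : Fml.iff φ ψ ∈ W ↔ (φ ∈ W ↔ ψ ∈ W) := by
  simp [Fml.iff, iff_def]

end World

/-- A formula is derivable from `Γ` if it belongs to every world that contains `Γ`. -/
theorem derivable_of_forall_world {Γ : List (Fml S)} {φ : Fml S}
    (h : ∀ W : World L, (∀ ψ ∈ Γ, ψ ∈ W) → φ ∈ W) : Derivable L Γ φ := by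
  by_contra hn
  have hc : Consistent L {ψ | ψ ∈ Fml.not φ :: Γ} := fun Δ hΔ hd => hn (hd.weaken hΔ).classical
  obtain ⟨W, hW⟩ := hc.exists_world
  have h1 : Fml.not φ ∈ W := hW _ (by simp)
  exact (W.mem_not.1 h1) (h W fun ψ hψ => hW _ (by simp [hψ]))

/-! ### Accessibility between worlds and the truth lemmas for modalities -/

namespace World

/-- The accessibility relation of a program. -/
def Acc (α : Prog S) (W W' : World L) : Prop := ∀ φ, Fml.box α φ ∈ W → φ ∈ W'

/-- Normality of the box. Since `G` needs an empty context, the hypotheses are first moved into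
implications and then discharged one by one with `K`. -/
theorem box_mem_of_derivable (W : World L) {α : Prog S} {Γ : List (Fml S)} : ∀ {φ : Fml S},
    Derivable L Γ φ → (∀ ψ ∈ Γ, Fml.box α ψ ∈ W) → Fml.box α φ ∈ W := by
  induction Γ with
  | nil => intro φ h _; exact W.mem_of_provable (.G h)
  | cons ψ Γ ih =>
    intro φ h hΓ
    have h1 := ih (.impR h) fun χ hχ => hΓ χ (by simp [hχ])
    have h2 := W.mem_of_provable (Derivable.K (L := L) (Γ := []) (α := α) (φ := ψ) (ψ := φ))
    simp only [mem_imp] at h2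
    exact h2 h1 (hΓ ψ (by simp))

/-- The existence lemma of canonical models: if the box formula is absent, the negated postcondition
is consistent with everything boxed in `W`, and any world extending this set is an accessible
counterexample. -/
theorem mem_box (W : World L) {α : Prog S} {φ : Fml S} :
    Fml.box α φ ∈ W ↔ ∀ W' : World L, W.Acc α W' → φ ∈ W' := by
  refine ⟨fun h W' hW' => hW' φ h, fun h => ?_⟩
  by_contra hn
  have hc : Consistent L (insert (.not φ) {ψ | Fml.box α ψ ∈ W}) := by
    classical
    intro Γ hΓ hd
    refine hn (W.box_mem_of_derivable (Γ := Γ.filter (· ≠ .not φ))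
      (Derivable.classical (hd.weaken ?_)) ?_)
    · intro ψ hψ
      by_cases h : ψ = .not φ <;> simp [h, hψ]
    · intro ψ hψ
      rw [List.mem_filter] at hψ
      rcases hΓ ψ hψ.1 with rfl | h
      · simp at hψ
      · exact h
  obtain ⟨W', hW'⟩ := hc.exists_world
  exact (W'.mem_not.1 (hW' _ (Set.mem_insert _ _)))
    (h W' fun ψ hψ => hW' ψ (Set.mem_insert_of_mem _ hψ))

theorem mem_dia (W : World L) {α : Prog S} {φ : Fml S} :
    Fml.dia α φ ∈ W ↔ ∃ W' : World L, W.Acc α W' ∧ φ ∈ W' := by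
  have := W.mem_of_provable (Derivable.diamond (L := L) (Γ := []) (α := α) (φ := φ))
  rw [mem_iff, mem_not, mem_box] at this
  simp [this]

theorem Acc.mem_of_disjoint {W W' : World L} {α : Prog S} (h : W.Acc α W') {φ : Fml S}
    (hd : Disjoint φ.fv α.bv) (hφ : φ ∈ W) : φ ∈ W' := by
  have := W.mem_of_provable (Derivable.V (L := L) (Γ := []) hd)
  rw [mem_imp] at this
  exact h φ (this hφ)

/-! ## The ordered ring of terms in a world -/

/-- Substitution of terms for the variables `(0, 0)`, `(1, 0)`, `(2, 0)`, `(3, 0)`. -/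
def quad (a b c d : Term S) : Var → Term S
  | (0, _) => a
  | (1, _) => b
  | (2, _) => c
  | (_, _) => d

theorem mem_arith (W : World L) (σ : Var → Term S) {ψ : Fml S} (h1 : ψ.IsArith)
    (h2 : ψ.SubstOK σ) (h3 : ψ.Valid L.interp) : ψ.subst σ ∈ W :=
  W.mem_of_provable (.arith h1 h3 h2)

/-- The polynomial variables used to state arithmetic facts. -/
abbrev pv (n : ℕ) : Term S := .var (n, 0)

theorem eq_refl (W : World L) (a : Term S) : Fml.eq a a ∈ W :=
  W.mem_arith (quad a a a a) (ψ := .eq (pv 0) (pv 0)) ⟨trivial, trivial⟩ ⟨trivial, trivial⟩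
    fun _ => rfl

/-- Quantifier-free facts about four real numbers hold for terms in a world. -/
theorem arith_imp (W : World L) (a b c d : Term S) (P Q : SA S)
    (hP : P.toFml.IsArith) (hQ : Q.toFml.IsArith)
    (hP' : P.toFml.SubstOK (quad a b c d)) (hQ' : Q.toFml.SubstOK (quad a b c d))
    (h : ∀ ω, P.toFml.Sat L.interp ω → Q.toFml.Sat L.interp ω)
    (hm : P.toFml.subst (quad a b c d) ∈ W) : Q.toFml.subst (quad a b c d) ∈ W := by
  have := W.mem_arith (quad a b c d) (ψ := .imp P.toFml Q.toFml) ⟨hP, hQ⟩ ⟨hP', hQ'⟩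
    fun ω => imp_iff_not_or.1 (h ω)
  have h2 : Fml.imp (P.toFml.subst (quad a b c d)) (Q.toFml.subst (quad a b c d)) ∈ W := this
  exact W.mem_imp.1 h2 hm

theorem eq_symm (W : World L) {a b : Term S} (h : Fml.eq a b ∈ W) : Fml.eq b a ∈ W :=
  W.arith_imp a b a a (.eq (pv 0) (pv 1)) (.eq (pv 1) (pv 0)) ⟨trivial, trivial⟩ ⟨trivial, trivial⟩
    ⟨trivial, trivial⟩ ⟨trivial, trivial⟩ (fun _ h => Eq.symm h) h

theorem eq_trans (W : World L) {a b c : Term S} (h : Fml.eq a b ∈ W) (h' : Fml.eq b c ∈ W) :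
    Fml.eq a c ∈ W :=
  W.arith_imp a b c a (.and (.eq (pv 0) (pv 1)) (.eq (pv 1) (pv 2))) (.eq (pv 0) (pv 2))
    ⟨⟨trivial, trivial⟩, ⟨trivial, trivial⟩⟩ ⟨trivial, trivial⟩
    ⟨⟨trivial, trivial⟩, ⟨trivial, trivial⟩⟩ ⟨trivial, trivial⟩
    (fun _ h => Eq.trans h.1 h.2) (W.mem_and.2 ⟨h, h'⟩)

/-- Provable equality of terms in a world. -/
def setoid (W : World L) : Setoid (Term S) where
  r a b := Fml.eq a b ∈ W
  iseqv := ⟨W.eq_refl, W.eq_symm, W.eq_trans⟩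

/-- The values of terms in a world. -/
def Val (W : World L) : Type := Quotient W.setoid

/-- The value of a term in a world. -/
def val (W : World L) (a : Term S) : W.Val := Quotient.mk W.setoid a

theorem mem_eq (W : World L) {a b : Term S} : Fml.eq a b ∈ W ↔ W.val a = W.val b :=
  (Quotient.eq (r := W.setoid)).symm

theorem add_congr (W : World L) {a b c d : Term S} (h : Fml.eq a b ∈ W) (h' : Fml.eq c d ∈ W) :
    Fml.eq (.add a c) (.add b d) ∈ W :=
  W.arith_imp a b c d (.and (.eq (pv 0) (pv 1)) (.eq (pv 2) (pv 3)))
    (.eq (.add (pv 0) (pv 2)) (.add (pv 1) (pv 3)))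
    ⟨⟨trivial, trivial⟩, ⟨trivial, trivial⟩⟩ ⟨⟨trivial, trivial⟩, ⟨trivial, trivial⟩⟩
    ⟨⟨trivial, trivial⟩, ⟨trivial, trivial⟩⟩ ⟨⟨trivial, trivial⟩, ⟨trivial, trivial⟩⟩
    (fun _ h => congrArg₂ (· + ·) h.1 h.2) (W.mem_and.2 ⟨h, h'⟩)

theorem mul_congr (W : World L) {a b c d : Term S} (h : Fml.eq a b ∈ W) (h' : Fml.eq c d ∈ W) :
    Fml.eq (.mul a c) (.mul b d) ∈ W :=
  W.arith_imp a b c d (.and (.eq (pv 0) (pv 1)) (.eq (pv 2) (pv 3)))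
    (.eq (.mul (pv 0) (pv 2)) (.mul (pv 1) (pv 3)))
    ⟨⟨trivial, trivial⟩, ⟨trivial, trivial⟩⟩ ⟨⟨trivial, trivial⟩, ⟨trivial, trivial⟩⟩
    ⟨⟨trivial, trivial⟩, ⟨trivial, trivial⟩⟩ ⟨⟨trivial, trivial⟩, ⟨trivial, trivial⟩⟩
    (fun _ h => congrArg₂ (· * ·) h.1 h.2) (W.mem_and.2 ⟨h, h'⟩)

/-- Polynomial identities hold in every world. -/
theorem mem_poly (W : World L) (a b c d : Term S) (p q : Term S) (hp : p.IsPoly) (hq : q.IsPoly)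
    (hp' : p.SubstOK (quad a b c d)) (hq' : q.SubstOK (quad a b c d))
    (h : ∀ ω, p.sem L.interp ω = q.sem L.interp ω) :
    W.val (p.subst (quad a b c d)) = W.val (q.subst (quad a b c d)) :=
  W.mem_eq.1 (W.mem_arith (quad a b c d) (ψ := .eq p q) ⟨hp, hq⟩ ⟨hp', hq'⟩ h)

instance (W : World L) : Add W.Val :=
  ⟨Quotient.map₂ Term.add fun _ _ h _ _ h' => W.add_congr h h'⟩
instance (W : World L) : Mul W.Val :=
  ⟨Quotient.map₂ Term.mul fun _ _ h _ _ h' => W.mul_congr h h'⟩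
instance (W : World L) : Zero W.Val := ⟨W.val (.const 0)⟩
instance (W : World L) : One W.Val := ⟨W.val (.const 1)⟩
instance (W : World L) : Neg W.Val := ⟨fun x => W.val (.const (-1)) * x⟩

@[simp] theorem val_add (W : World L) (a b : Term S) : W.val (.add a b) = W.val a + W.val b := rfl
@[simp] theorem val_mul (W : World L) (a b : Term S) : W.val (.mul a b) = W.val a * W.val b := rfl
@[simp] theorem val_zero (W : World L) : W.val (.const 0) = 0 := rfl
@[simp] theorem val_one (W : World L) : W.val (.const 1) = 1 := rfl
theorem val_const_neg_one_mul (W : World L) (x : W.Val) : W.val (.const (-1)) * x = -x := rfl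

theorem val_surjective (W : World L) (x : W.Val) : ∃ a, W.val a = x := Quotient.exists_rep x

/-- Each ring axiom is an instance of a valid polynomial identity. Together with the order below,
this lets `ring`, `linarith` and `nlinarith` replace derivations in the calculus. -/
instance (W : World L) : CommRing W.Val where
  add_assoc x y z := by
    obtain ⟨a, rfl⟩ := W.val_surjective x
    obtain ⟨b, rfl⟩ := W.val_surjective y
    obtain ⟨c, rfl⟩ := W.val_surjective z
    exact W.mem_poly a b c c (.add (.add (pv 0) (pv 1)) (pv 2)) (.add (pv 0) (.add (pv 1) (pv 2)))
      ⟨⟨trivial, trivial⟩, trivial⟩ ⟨trivial, trivial, trivial⟩ ⟨⟨trivial, trivial⟩, trivial⟩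
      ⟨trivial, trivial, trivial⟩ fun _ => add_assoc _ _ _
  add_comm x y := by
    obtain ⟨a, rfl⟩ := W.val_surjective x
    obtain ⟨b, rfl⟩ := W.val_surjective y
    exact W.mem_poly a b a a (.add (pv 0) (pv 1)) (.add (pv 1) (pv 0))
      ⟨trivial, trivial⟩ ⟨trivial, trivial⟩ ⟨trivial, trivial⟩ ⟨trivial, trivial⟩
      fun _ => add_comm _ _
  zero_add x := by
    obtain ⟨a, rfl⟩ := W.val_surjective x
    exact W.mem_poly a a a a (.add (.const 0) (pv 0)) (pv 0)
      ⟨trivial, trivial⟩ trivial ⟨trivial, trivial⟩ trivial fun _ => by simp [Term.sem]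
  add_zero x := by
    obtain ⟨a, rfl⟩ := W.val_surjective x
    exact W.mem_poly a a a a (.add (pv 0) (.const 0)) (pv 0)
      ⟨trivial, trivial⟩ trivial ⟨trivial, trivial⟩ trivial fun _ => by simp [Term.sem]
  mul_assoc x y z := by
    obtain ⟨a, rfl⟩ := W.val_surjective x
    obtain ⟨b, rfl⟩ := W.val_surjective y
    obtain ⟨c, rfl⟩ := W.val_surjective z
    exact W.mem_poly a b c c (.mul (.mul (pv 0) (pv 1)) (pv 2)) (.mul (pv 0) (.mul (pv 1) (pv 2)))
      ⟨⟨trivial, trivial⟩, trivial⟩ ⟨trivial, trivial, trivial⟩ ⟨⟨trivial, trivial⟩, trivial⟩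
      ⟨trivial, trivial, trivial⟩ fun _ => mul_assoc _ _ _
  mul_comm x y := by
    obtain ⟨a, rfl⟩ := W.val_surjective x
    obtain ⟨b, rfl⟩ := W.val_surjective y
    exact W.mem_poly a b a a (.mul (pv 0) (pv 1)) (.mul (pv 1) (pv 0))
      ⟨trivial, trivial⟩ ⟨trivial, trivial⟩ ⟨trivial, trivial⟩ ⟨trivial, trivial⟩
      fun _ => mul_comm _ _
  one_mul x := by
    obtain ⟨a, rfl⟩ := W.val_surjective x
    exact W.mem_poly a a a a (.mul (.const 1) (pv 0)) (pv 0)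
      ⟨trivial, trivial⟩ trivial ⟨trivial, trivial⟩ trivial fun _ => by simp [Term.sem]
  mul_one x := by
    obtain ⟨a, rfl⟩ := W.val_surjective x
    exact W.mem_poly a a a a (.mul (pv 0) (.const 1)) (pv 0)
      ⟨trivial, trivial⟩ trivial ⟨trivial, trivial⟩ trivial fun _ => by simp [Term.sem]
  zero_mul x := by
    obtain ⟨a, rfl⟩ := W.val_surjective x
    exact W.mem_poly a a a a (.mul (.const 0) (pv 0)) (.const 0)
      ⟨trivial, trivial⟩ trivial ⟨trivial, trivial⟩ trivial fun _ => by simp [Term.sem]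
  mul_zero x := by
    obtain ⟨a, rfl⟩ := W.val_surjective x
    exact W.mem_poly a a a a (.mul (pv 0) (.const 0)) (.const 0)
      ⟨trivial, trivial⟩ trivial ⟨trivial, trivial⟩ trivial fun _ => by simp [Term.sem]
  left_distrib x y z := by
    obtain ⟨a, rfl⟩ := W.val_surjective x
    obtain ⟨b, rfl⟩ := W.val_surjective y
    obtain ⟨c, rfl⟩ := W.val_surjective z
    exact W.mem_poly a b c c (.mul (pv 0) (.add (pv 1) (pv 2)))
      (.add (.mul (pv 0) (pv 1)) (.mul (pv 0) (pv 2)))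
      ⟨trivial, trivial, trivial⟩ ⟨⟨trivial, trivial⟩, trivial, trivial⟩
      ⟨trivial, trivial, trivial⟩ ⟨⟨trivial, trivial⟩, trivial, trivial⟩ fun _ => mul_add _ _ _
  right_distrib x y z := by
    obtain ⟨a, rfl⟩ := W.val_surjective x
    obtain ⟨b, rfl⟩ := W.val_surjective y
    obtain ⟨c, rfl⟩ := W.val_surjective z
    exact W.mem_poly a b c c (.mul (.add (pv 0) (pv 1)) (pv 2))
      (.add (.mul (pv 0) (pv 2)) (.mul (pv 1) (pv 2)))
      ⟨⟨trivial, trivial⟩, trivial⟩ ⟨⟨trivial, trivial⟩, trivial, trivial⟩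
      ⟨⟨trivial, trivial⟩, trivial⟩ ⟨⟨trivial, trivial⟩, trivial, trivial⟩ fun _ => add_mul _ _ _
  neg_add_cancel x := by
    obtain ⟨a, rfl⟩ := W.val_surjective x
    exact W.mem_poly a a a a (.add (.mul (.const (-1)) (pv 0)) (pv 0)) (.const 0)
      ⟨⟨trivial, trivial⟩, trivial⟩ trivial ⟨⟨trivial, trivial⟩, trivial⟩ trivial
      fun _ => by simp [Term.sem]
  nsmul := nsmulRec
  zsmul := zsmulRec

@[simp] theorem val_neg_one (W : World L) : W.val (.const (-1)) = -1 := by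
  rw [← W.val_const_neg_one_mul, mul_one]

theorem val_const_mul (W : World L) (p q : ℚ) :
    W.val (.const (p * q)) = W.val (.const p) * W.val (.const q) :=
  W.mem_poly (.const 0) (.const 0) (.const 0) (.const 0) (.const (p * q))
    (.mul (.const p) (.const q)) trivial ⟨trivial, trivial⟩ trivial ⟨trivial, trivial⟩
    fun _ => by simp [Term.sem]

theorem val_const_add (W : World L) (p q : ℚ) :
    W.val (.const (p + q)) = W.val (.const p) + W.val (.const q) :=
  W.mem_poly (.const 0) (.const 0) (.const 0) (.const 0) (.const (p + q))
    (.add (.const p) (.const q)) trivial ⟨trivial, trivial⟩ trivial ⟨trivial, trivial⟩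
    fun _ => by simp [Term.sem]

theorem val_const_natCast (W : World L) (n : ℕ) : W.val (.const n) = n := by
  induction n with
  | zero => simp
  | succ n ih => simp [Nat.cast_succ, val_const_add, ih]

theorem mem_ge_congr (W : World L) {a b c d : Term S} (h : Fml.eq a b ∈ W) (h' : Fml.eq c d ∈ W)
    (hac : Fml.ge c a ∈ W) : Fml.ge d b ∈ W :=
  W.arith_imp a b c d (.and (.and (.eq (pv 0) (pv 1)) (.eq (pv 2) (pv 3))) (.ge (pv 2) (pv 0)))
    (.ge (pv 3) (pv 1))
    ⟨⟨⟨trivial, trivial⟩, ⟨trivial, trivial⟩⟩, ⟨trivial, trivial⟩⟩ ⟨trivial, trivial⟩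
    ⟨⟨⟨trivial, trivial⟩, ⟨trivial, trivial⟩⟩, ⟨trivial, trivial⟩⟩ ⟨trivial, trivial⟩
    (fun _ ⟨⟨h1, h2⟩, h3⟩ => by
      simp only [SA.toFml, Fml.Sat] at *; rw [← h1, ← h2]; exact h3)
    (W.mem_and.2 ⟨W.mem_and.2 ⟨h, h'⟩, hac⟩)

theorem mem_gt_iff_not_ge (W : World L) {a b : Term S} : Fml.gt a b ∈ W ↔ Fml.ge b a ∉ W := by
  have := W.mem_arith (quad a b a a) (ψ := .iff (.gt (pv 0) (pv 1)) (.not (.ge (pv 1) (pv 0))))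
    ⟨⟨⟨trivial, trivial⟩, ⟨trivial, trivial⟩⟩, ⟨⟨trivial, trivial⟩, ⟨trivial, trivial⟩⟩⟩
    ⟨⟨⟨trivial, trivial⟩, ⟨trivial, trivial⟩⟩, ⟨⟨trivial, trivial⟩, ⟨trivial, trivial⟩⟩⟩
    (fun ω => by
      simp only [Fml.iff, Fml.imp, Fml.Sat]
      constructor
      · rw [← imp_iff_not_or]; exact not_le_of_gt
      · rw [← imp_iff_not_or]; exact lt_of_not_ge)
  have h : Fml.iff (.gt a b) (.not (.ge b a)) ∈ W := this
  simpa using h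

instance (W : World L) : LE W.Val :=
  ⟨Quotient.lift₂ (fun a b => Fml.ge b a ∈ W) fun _ _ _ _ h h' => propext
    ⟨W.mem_ge_congr h h', W.mem_ge_congr (W.eq_symm h) (W.eq_symm h')⟩⟩

theorem mem_ge (W : World L) {a b : Term S} : Fml.ge a b ∈ W ↔ W.val b ≤ W.val a := Iff.rfl

open Classical in
instance (W : World L) : LinearOrder W.Val where
  le_refl x := by
    obtain ⟨a, rfl⟩ := W.val_surjective x
    exact W.mem_arith (quad a a a a) (ψ := .ge (pv 0) (pv 0)) ⟨trivial, trivial⟩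
      ⟨trivial, trivial⟩ fun _ => le_refl _
  le_trans x y z h h' := by
    obtain ⟨a, rfl⟩ := W.val_surjective x
    obtain ⟨b, rfl⟩ := W.val_surjective y
    obtain ⟨c, rfl⟩ := W.val_surjective z
    exact W.arith_imp a b c c (.and (.ge (pv 1) (pv 0)) (.ge (pv 2) (pv 1))) (.ge (pv 2) (pv 0))
      ⟨⟨trivial, trivial⟩, ⟨trivial, trivial⟩⟩ ⟨trivial, trivial⟩
      ⟨⟨trivial, trivial⟩, ⟨trivial, trivial⟩⟩ ⟨trivial, trivial⟩
      (fun _ h => le_trans (α := ℝ) h.1 h.2) (W.mem_and.2 ⟨h, h'⟩)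
  le_antisymm x y h h' := by
    obtain ⟨a, rfl⟩ := W.val_surjective x
    obtain ⟨b, rfl⟩ := W.val_surjective y
    exact W.mem_eq.1 <| W.arith_imp a b a a (.and (.ge (pv 1) (pv 0)) (.ge (pv 0) (pv 1)))
      (.eq (pv 0) (pv 1))
      ⟨⟨trivial, trivial⟩, ⟨trivial, trivial⟩⟩ ⟨trivial, trivial⟩
      ⟨⟨trivial, trivial⟩, ⟨trivial, trivial⟩⟩ ⟨trivial, trivial⟩
      (fun _ h => le_antisymm (α := ℝ) h.1 h.2) (W.mem_and.2 ⟨h, h'⟩)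
  le_total x y := by
    obtain ⟨a, rfl⟩ := W.val_surjective x
    obtain ⟨b, rfl⟩ := W.val_surjective y
    exact W.mem_or.1 <| W.mem_arith (quad a b a a)
      (ψ := .or (.ge (pv 1) (pv 0)) (.ge (pv 0) (pv 1)))
      ⟨⟨trivial, trivial⟩, ⟨trivial, trivial⟩⟩ ⟨⟨trivial, trivial⟩, ⟨trivial, trivial⟩⟩
      (fun _ => le_total (α := ℝ) _ _)
  toDecidableLE := Classical.decRel _

theorem mem_gt (W : World L) {a b : Term S} : Fml.gt a b ∈ W ↔ W.val b < W.val a := by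
  rw [mem_gt_iff_not_ge, mem_ge, not_le]

instance (W : World L) : IsStrictOrderedRing W.Val where
  add_le_add_left x y h z := by
    obtain ⟨a, rfl⟩ := W.val_surjective x
    obtain ⟨b, rfl⟩ := W.val_surjective y
    obtain ⟨c, rfl⟩ := W.val_surjective z
    exact W.arith_imp a b c c (.ge (pv 1) (pv 0))
      (.ge (.add (pv 1) (pv 2)) (.add (pv 0) (pv 2)))
      ⟨trivial, trivial⟩ ⟨⟨trivial, trivial⟩, ⟨trivial, trivial⟩⟩
      ⟨trivial, trivial⟩ ⟨⟨trivial, trivial⟩, ⟨trivial, trivial⟩⟩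
      (fun _ h => add_le_add_left (α := ℝ) h _) h
  le_of_add_le_add_left x y z h := by
    obtain ⟨a, rfl⟩ := W.val_surjective x
    obtain ⟨b, rfl⟩ := W.val_surjective y
    obtain ⟨c, rfl⟩ := W.val_surjective z
    exact W.arith_imp a b c c (.ge (.add (pv 0) (pv 2)) (.add (pv 0) (pv 1)))
      (.ge (pv 2) (pv 1)) ⟨⟨trivial, trivial⟩, ⟨trivial, trivial⟩⟩ ⟨trivial, trivial⟩
      ⟨⟨trivial, trivial⟩, ⟨trivial, trivial⟩⟩ ⟨trivial, trivial⟩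
      (fun _ h => le_of_add_le_add_left (α := ℝ) h) h
  zero_le_one := W.mem_arith (quad (.const 0) (.const 0) (.const 0) (.const 0))
      (ψ := .ge (.const 1) (.const 0)) ⟨trivial, trivial⟩
      ⟨trivial, trivial⟩ fun _ => by simp [Fml.Sat, Term.sem]
  -- `Fml.fls` is the equation `0 = 1`, so consistency is precisely nontriviality.
  exists_pair_ne := ⟨0, 1, fun h => W.fls_notMem (W.mem_eq.2 h)⟩
  mul_lt_mul_of_pos_left x hx y z h := by
    obtain ⟨a, rfl⟩ := W.val_surjective x
    obtain ⟨b, rfl⟩ := W.val_surjective y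
    obtain ⟨c, rfl⟩ := W.val_surjective z
    exact W.mem_gt.1 <| W.arith_imp a b c c (.and (.gt (pv 0) (.const 0)) (.gt (pv 2) (pv 1)))
      (.gt (.mul (pv 0) (pv 2)) (.mul (pv 0) (pv 1)))
      ⟨⟨trivial, trivial⟩, ⟨trivial, trivial⟩⟩ ⟨⟨trivial, trivial⟩, ⟨trivial, trivial⟩⟩
      ⟨⟨trivial, trivial⟩, ⟨trivial, trivial⟩⟩ ⟨⟨trivial, trivial⟩, ⟨trivial, trivial⟩⟩
      (fun _ h => mul_lt_mul_of_pos_left (α := ℝ) h.2 (by simpa [SA.toFml, Fml.Sat, Term.sem] using h.1))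
      (W.mem_and.2 ⟨W.mem_gt.2 hx, W.mem_gt.2 h⟩)
  mul_lt_mul_of_pos_right x hx y z h := by
    obtain ⟨a, rfl⟩ := W.val_surjective x
    obtain ⟨b, rfl⟩ := W.val_surjective y
    obtain ⟨c, rfl⟩ := W.val_surjective z
    exact W.mem_gt.1 <| W.arith_imp a b c c (.and (.gt (pv 0) (.const 0)) (.gt (pv 2) (pv 1)))
      (.gt (.mul (pv 2) (pv 0)) (.mul (pv 1) (pv 0)))
      ⟨⟨trivial, trivial⟩, ⟨trivial, trivial⟩⟩ ⟨⟨trivial, trivial⟩, ⟨trivial, trivial⟩⟩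
      ⟨⟨trivial, trivial⟩, ⟨trivial, trivial⟩⟩ ⟨⟨trivial, trivial⟩, ⟨trivial, trivial⟩⟩
      (fun _ h => mul_lt_mul_of_pos_right (α := ℝ) h.2 (by simpa [SA.toFml, Fml.Sat, Term.sem] using h.1))
      (W.mem_and.2 ⟨W.mem_gt.2 hx, W.mem_gt.2 h⟩)

attribute [simp] mem_eq mem_ge mem_gt

theorem val_sum (W : World L) (l : List (Term S)) : W.val (Term.sum l) = (l.map W.val).sum := by
  induction l with
  | nil => rfl
  | cons a l ih => simp [Term.sum, ih]

end World

/-! ## Free variables and substitutions -/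

theorem Term.DiffFree.snd_eq_zero {e : Term S} (he : e.DiffFree) : ∀ v ∈ e.fv, v.2 = 0 := by
  induction e with
  | var v => rintro w rfl; exact he
  | const c => simp [Term.fv]
  | add a b iha ihb => exact fun v hv => hv.elim (iha he.1 v) (ihb he.2 v)
  | mul a b iha ihb => exact fun v hv => hv.elim (iha he.1 v) (ihb he.2 v)
  | app h args ih =>
    intro v hv
    obtain ⟨i, hi⟩ := Set.mem_iUnion.1 hv
    exact ih i (he i) v hi
  | diff e _ => exact he.elim

theorem Term.fv_finite (e : Term S) : e.fv.Finite := by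
  induction e with
  | var v => exact Set.finite_singleton v
  | const c => exact Set.finite_empty
  | add a b iha ihb => exact iha.union ihb
  | mul a b iha ihb => exact iha.union ihb
  | app h args ih => exact Set.finite_iUnion ih
  | diff e ih => exact ih.union (ih.image _)

theorem SA.fv_finite (Q : SA S) : Q.fv.Finite := by
  induction Q with
  | eq a b => exact a.fv_finite.union b.fv_finite
  | ge a b => exact a.fv_finite.union b.fv_finite
  | gt a b => exact a.fv_finite.union b.fv_finite
  | not P ih => exact ih
  | and P Q ihP ihQ => exact ihP.union ihQ
  | or P Q ihP ihQ => exact ihP.union ihQ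

theorem ODE.rhsFv_finite (sys : ODE S) : sys.rhsFv.Finite := by
  have : sys.rhsFv = ⋃ p ∈ {p | p ∈ sys}, p.2.fv := by
    ext v; simp [ODE.rhsFv]
  rw [this]
  exact (List.finite_toSet sys).biUnion fun p _ => p.2.fv_finite

theorem Term.subst_eq_self {σ : Var → Term S} {e : Term S} (h : ∀ v ∈ e.fv, σ v = .var v) :
    e.subst σ = e ∧ e.SubstOK σ := by
  induction e with
  | var v => exact ⟨h v rfl, trivial⟩
  | const c => exact ⟨rfl, trivial⟩
  | add a b iha ihb =>
    obtain ⟨h1, h2⟩ := iha fun v hv => h v (Or.inl hv)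
    obtain ⟨h3, h4⟩ := ihb fun v hv => h v (Or.inr hv)
    exact ⟨by rw [Term.subst, h1, h3], h2, h4⟩
  | mul a b iha ihb =>
    obtain ⟨h1, h2⟩ := iha fun v hv => h v (Or.inl hv)
    obtain ⟨h3, h4⟩ := ihb fun v hv => h v (Or.inr hv)
    exact ⟨by rw [Term.subst, h1, h3], h2, h4⟩
  | app g args ih =>
    have := fun i => ih i fun v hv => h v (Set.mem_iUnion.2 ⟨i, hv⟩)
    exact ⟨by rw [Term.subst]; congr 1; funext i; exact (this i).1, fun i => (this i).2⟩
  | diff e _ => exact ⟨rfl, h⟩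

@[simp] theorem shield_var (B : Set Var) : shield B (Term.var (S := S)) = Term.var := by
  funext v; simp [shield]

theorem SA.subst_var (Q : SA S) : Q.subst Term.var = Q ∧ Q.SubstOK Term.var := by
  have ht := fun e : Term S => e.subst_eq_self (σ := Term.var) fun _ _ => rfl
  induction Q with
  | eq a b => exact ⟨by rw [SA.subst, (ht a).1, (ht b).1], (ht a).2, (ht b).2⟩
  | ge a b => exact ⟨by rw [SA.subst, (ht a).1, (ht b).1], (ht a).2, (ht b).2⟩
  | gt a b => exact ⟨by rw [SA.subst, (ht a).1, (ht b).1], (ht a).2, (ht b).2⟩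
  | not P ih => exact ⟨by rw [SA.subst, ih.1], ih.2⟩
  | and P Q ihP ihQ => exact ⟨by rw [SA.subst, ihP.1, ihQ.1], ihP.2, ihQ.2⟩
  | or P Q ihP ihQ => exact ⟨by rw [SA.subst, ihP.1, ihQ.1], ihP.2, ihQ.2⟩

theorem Prog.subst_var (α : Prog S) : α.subst Term.var = α ∧ α.SubstOK Term.var := by
  have ht := fun e : Term S => e.subst_eq_self (σ := Term.var) fun _ _ => rfl
  cases α with
  | ode sys Q =>
    refine ⟨?_, fun _ _ => rfl, fun v _ hv => by simpa [Term.fv] using hv, ?_, ?_⟩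
    · rw [Prog.subst, shield_var, Q.subst_var.1]
      congr 1
      conv_rhs => rw [← List.map_id sys]
      exact List.map_congr_left fun p _ => by simp [(ht p.2).1]
    · rw [shield_var]; exact fun p _ => (ht p.2).2
    · rw [shield_var]; exact Q.subst_var.2
  | assign x e => exact ⟨by rw [Prog.subst, (ht e).1], (ht e).2⟩

/-- Needed to apply the quantifier rules with the bound variable itself as witness or eigenvariable.
-/
theorem Fml.subst_var (φ : Fml S) : φ.subst Term.var = φ ∧ φ.SubstOK Term.var := by
  have ht := fun e : Term S => e.subst_eq_self (σ := Term.var) fun _ _ => rfl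
  induction φ with
  | eq a b => exact ⟨by rw [Fml.subst, (ht a).1, (ht b).1], (ht a).2, (ht b).2⟩
  | ge a b => exact ⟨by rw [Fml.subst, (ht a).1, (ht b).1], (ht a).2, (ht b).2⟩
  | gt a b => exact ⟨by rw [Fml.subst, (ht a).1, (ht b).1], (ht a).2, (ht b).2⟩
  | not P ih => exact ⟨by rw [Fml.subst, ih.1], ih.2⟩
  | and P Q ihP ihQ => exact ⟨by rw [Fml.subst, ihP.1, ihQ.1], ihP.2, ihQ.2⟩
  | or P Q ihP ihQ => exact ⟨by rw [Fml.subst, ihP.1, ihQ.1], ihP.2, ihQ.2⟩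
  | all x φ ih =>
    rw [Fml.subst, Fml.SubstOK, shield_var, ih.1]
    exact ⟨rfl, fun v _ hv => by simpa [Term.fv] using hv.symm, ih.2⟩
  | ex x φ ih =>
    rw [Fml.subst, Fml.SubstOK, shield_var, ih.1]
    exact ⟨rfl, fun v _ hv => by simpa [Term.fv] using hv.symm, ih.2⟩
  | box α φ ih =>
    rw [Fml.subst, Fml.SubstOK, shield_var, ih.1, α.subst_var.1]
    exact ⟨rfl, α.subst_var.2, fun v _ hv => by simpa [Term.fv] using hv, ih.2⟩
  | dia α φ ih =>
    rw [Fml.subst, Fml.SubstOK, shield_var, ih.1, α.subst_var.1]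
    exact ⟨rfl, α.subst_var.2, fun v _ hv => by simpa [Term.fv] using hv, ih.2⟩

theorem single_var (x : Var) : single x (Term.var (S := S) x) = Term.var :=
  Function.update_eq_self x Term.var

theorem single_of_ne {x v : Var} {e : Term S} (h : v ≠ x) : single x e v = .var v :=
  Function.update_of_ne h _ _

theorem single_self {x : Var} {e : Term S} : single x e x = e := Function.update_self ..

/-! ## Lie derivatives -/

theorem Term.sum_diffFree {l : List (Term S)} (h : ∀ e ∈ l, e.DiffFree) :
    (Term.sum l).DiffFree := by
  induction l with
  | nil => trivial
  | cons a l ih => exact ⟨h a (by simp), ih fun e he => h e (by simp [he])⟩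

theorem Term.mem_fv_sum {l : List (Term S)} {v : Var} :
    v ∈ (Term.sum l).fv ↔ ∃ e ∈ l, v ∈ e.fv := by
  induction l with
  | nil => simp [Term.sum, Term.fv]
  | cons a l ih => simp [Term.sum, Term.fv, ih]

theorem Term.subst_diffFree {σ : Var → Term S} {e : Term S} (he : e.DiffFree)
    (hσ : ∀ v, v.2 = 0 → (σ v).DiffFree) : (e.subst σ).DiffFree := by
  induction e with
  | var v => exact hσ v he
  | const c => trivial
  | add a b iha ihb => exact ⟨iha he.1, ihb he.2⟩
  | mul a b iha ihb => exact ⟨iha he.1, ihb he.2⟩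
  | app h args ih => exact fun i => ih i (he i)
  | diff e _ => exact he.elim

theorem Term.fv_subst {σ : Var → Term S} {e : Term S} (he : e.DiffFree) {v : Var}
    (hv : v ∈ (e.subst σ).fv) : ∃ w ∈ e.fv, v ∈ (σ w).fv := by
  induction e with
  | var w => exact ⟨w, rfl, hv⟩
  | const c => exact hv.elim
  | add a b iha ihb =>
    rcases hv with hv | hv
    · obtain ⟨w, h1, h2⟩ := iha he.1 hv; exact ⟨w, Or.inl h1, h2⟩
    · obtain ⟨w, h1, h2⟩ := ihb he.2 hv; exact ⟨w, Or.inr h1, h2⟩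
  | mul a b iha ihb =>
    rcases hv with hv | hv
    · obtain ⟨w, h1, h2⟩ := iha he.1 hv; exact ⟨w, Or.inl h1, h2⟩
    · obtain ⟨w, h1, h2⟩ := ihb he.2 hv; exact ⟨w, Or.inr h1, h2⟩
  | app h args ih =>
    obtain ⟨i, hi⟩ := Set.mem_iUnion.1 hv
    obtain ⟨w, h1, h2⟩ := ih i (he i) hi
    exact ⟨w, Set.mem_iUnion.2 ⟨i, h1⟩, h2⟩
  | diff e _ => exact he.elim

theorem Term.inst_diffFree {k : ℕ} {t : Term S} {args : Fin k → Term S} (ht : t.DiffFree)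
    (h : ∀ i, (args i).DiffFree) : (t.inst args).DiffFree :=
  Term.subst_diffFree ht fun v hv => by
    split_ifs
    exacts [h _, hv]

theorem ExtLang.fv_inst_pd (L : ExtLang S) {h : S.Sym} {i : Fin (S.arity h)}
    {args : Fin (S.arity h) → Term S} {v : Var} (hv : v ∈ ((L.pd h i).inst args).fv) :
    ∃ j, v ∈ (args j).fv := by
  obtain ⟨w, h1, h2⟩ := Term.fv_subst (L.pd_diffFree h i) hv
  have h3 := L.pd_fv h i w h1
  rw [dif_pos h3] at h2
  exact ⟨_, h2⟩

theorem ODE.mem_lhs {sys : ODE S} {p : ℕ × Term S} (hp : p ∈ sys) : p.1 ∈ sys.lhs :=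
  List.mem_map_of_mem hp

theorem ODE.field_cases (sys : ODE S) (n : ℕ) :
    (∃ p ∈ sys, p.1 = n ∧ sys.field (n, 0) = p.2) ∨
      (n ∉ sys.lhs ∧ sys.field (n, 0) = .const 0) := by
  unfold ODE.field
  cases h : sys.find? (fun p => p.1 = n) with
  | some p =>
    refine Or.inl ⟨p, List.mem_of_find?_eq_some h, by simpa using List.find?_some h, ?_⟩
    simp
  | none =>
    refine Or.inr ⟨fun hn => ?_, by simp⟩
    obtain ⟨p, hp, rfl⟩ := List.mem_map.1 hn
    simpa using List.find?_eq_none.1 h p hp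

theorem ODE.WF.field_diffFree {sys : ODE S} (hsys : sys.WF) (v : Var) (hv : v.2 = 0) :
    (sys.field v).DiffFree := by
  obtain ⟨n, m⟩ := v
  obtain rfl : m = 0 := hv
  rcases sys.field_cases n with ⟨p, hp, -, h⟩ | ⟨-, h⟩
  · rw [h]; exact hsys.2 p hp
  · rw [h]; trivial

theorem ODE.WF.field_of_mem {sys : ODE S} (hsys : sys.WF) {p : ℕ × Term S} (hp : p ∈ sys) :
    sys.field (p.1, 0) = p.2 := by
  rcases sys.field_cases p.1 with ⟨q, hq, h, h'⟩ | ⟨h, -⟩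
  · rw [h', List.inj_on_of_nodup_map hsys.1 hq hp h]
  · exact absurd (ODE.mem_lhs hp) h

theorem ODE.WF.lie_diffFree {sys : ODE S} (hsys : sys.WF) {e : Term S} (he : e.DiffFree) :
    (lie L sys e).DiffFree := by
  induction e with
  | var v => exact hsys.field_diffFree v he
  | const c => trivial
  | add a b iha ihb => exact ⟨iha he.1, ihb he.2⟩
  | mul a b iha ihb => exact ⟨⟨iha he.1, he.2⟩, he.1, ihb he.2⟩
  | app h args ih =>
    refine Term.sum_diffFree fun t ht => ?_
    obtain ⟨i, rfl⟩ := List.mem_ofFn.1 ht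
    exact ⟨Term.inst_diffFree (L.pd_diffFree h i) he, ih i (he i)⟩
  | diff e _ => trivial

theorem fv_lie {sys : ODE S} {e : Term S} (he : e.DiffFree) {v : Var}
    (hv : v ∈ (lie L sys e).fv) : v ∈ e.fv ∪ sys.rhsFv := by
  induction e with
  | var w =>
    obtain ⟨n, m⟩ := w
    obtain rfl : m = 0 := he
    rcases sys.field_cases n with ⟨p, hp, -, h⟩ | ⟨-, h⟩
    · rw [lie, h] at hv; exact Or.inr ⟨p, hp, hv⟩
    · rw [lie, h] at hv; exact hv.elim
  | const c => exact hv.elim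
  | add a b iha ihb =>
    rcases hv with hv | hv
    · exact (iha he.1 hv).imp_left Or.inl
    · exact (ihb he.2 hv).imp_left Or.inr
  | mul a b iha ihb =>
    rcases hv with (hv | hv) | (hv | hv)
    · exact (iha he.1 hv).imp_left Or.inl
    · exact Or.inl (Or.inr hv)
    · exact Or.inl (Or.inl hv)
    · exact (ihb he.2 hv).imp_left Or.inr
  | app h args ih =>
    obtain ⟨t, ht, hv⟩ := Term.mem_fv_sum.1 hv
    obtain ⟨i, rfl⟩ := List.mem_ofFn.1 ht
    rcases hv with hv | hv
    · exact Or.inl (Set.mem_iUnion.2 (L.fv_inst_pd hv))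
    · exact (ih i (he i) hv).imp_left fun h => Set.mem_iUnion.2 ⟨i, h⟩
  | diff e _ => exact hv.elim

theorem ODE.lhs_append (sys : ODE S) (y : ℕ) (a : Term S) :
    ODE.lhs (sys ++ [(y, a)]) = sys.lhs ++ [y] := by simp [ODE.lhs]

theorem ODE.WF.append {sys : ODE S} (hsys : sys.WF) {y : ℕ} (hy : y ∉ sys.lhs) {a : Term S}
    (ha : a.DiffFree) : ODE.WF (sys ++ [(y, a)]) := by
  refine ⟨?_, ?_⟩
  · rw [ODE.lhs_append]
    exact hsys.1.append (List.nodup_singleton y) (by simpa using hy)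
  · intro p hp
    rcases List.mem_append.1 hp with hp | hp
    · exact hsys.2 p hp
    · rw [List.mem_singleton.1 hp]; exact ha

theorem lie_append {sys : ODE S} {y : ℕ} {a : Term S} {e : Term S} (he : e.DiffFree)
    (hy : (y, 0) ∉ e.fv) : lie L (sys ++ [(y, a)]) e = lie L sys e := by
  induction e with
  | var v =>
    have hv : y ≠ v.1 := fun h => hy (by rw [h]; exact Set.mem_singleton_iff.2 (by
      rw [← (show v.2 = 0 from he)]))
    simp [lie, ODE.field, List.find?_append, hv]
  | const c => rfl
  | add a b iha ihb =>
    rw [lie, lie, iha he.1 fun h => hy (Or.inl h), ihb he.2 fun h => hy (Or.inr h)]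
  | mul a b iha ihb =>
    rw [lie, lie, iha he.1 fun h => hy (Or.inl h), ihb he.2 fun h => hy (Or.inr h)]
  | app h args ih =>
    rw [lie, lie]
    congr 2
    funext i
    rw [ih i (he i) fun h => hy (Set.mem_iUnion.2 ⟨i, h⟩)]
  | diff e _ => rfl

theorem lieIter_succ (sys : ODE S) (i : ℕ) (e : Term S) :
    lieIter L sys (i + 1) e = lie L sys (lieIter L sys i e) :=
  Function.iterate_succ_apply' ..

theorem ODE.WF.lieIter_diffFree {sys : ODE S} (hsys : sys.WF) {e : Term S} (he : e.DiffFree)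
    (i : ℕ) : (lieIter L sys i e).DiffFree := by
  induction i with
  | zero => exact he
  | succ i ih => rw [lieIter_succ]; exact hsys.lie_diffFree ih

theorem ODE.WF.notMem_fv_lieIter {sys : ODE S} (hsys : sys.WF) {e : Term S} (he : e.DiffFree)
    {v : Var} (h1 : v ∉ e.fv) (h2 : v ∉ sys.rhsFv) (i : ℕ) : v ∉ (lieIter L sys i e).fv := by
  induction i with
  | zero => exact h1
  | succ i ih =>
    rw [lieIter_succ]
    exact fun h => (fv_lie (hsys.lieIter_diffFree he i) h).elim ih h2

namespace World

/-! ## Assignments and differentials -/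

/-- All that is used about a world reached by `x := e`: it keeps the formulas without `x` (axiom
`V`), and it contains `x = e`, because substituting `e` in this equation yields `e = e`. -/
theorem box_assign_intro (W : World L) {x : Var} {e : Term S} {φ : Fml S} (hx : x ∉ e.fv)
    (h : ∀ W' : World L, (∀ χ : Fml S, x ∉ χ.fv → χ ∈ W → χ ∈ W') → W'.val (.var x) = W'.val e →
      φ ∈ W') : Fml.box (.assign x e) φ ∈ W := by
  refine W.mem_box.2 fun W' hW' => h W' (fun χ hχ hm => ?_) ?_
  · exact hW'.mem_of_disjoint (Set.disjoint_singleton_right.2 hχ) hm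
  · have he := e.subst_eq_self (σ := single x e) fun v hv =>
      single_of_ne fun h => hx (h ▸ hv)
    have h1 := W.mem_of_provable (Derivable.assign (L := L) (Γ := []) (x := x) (e := e)
      (φ := .eq (.var x) e) ⟨trivial, he.2⟩)
    rw [mem_iff, Fml.subst, Term.subst, single_self, he.1] at h1
    exact W'.mem_eq.1 (hW' _ (h1.2 (W.eq_refl e)))

theorem assignZero_intro {φ : Fml S} {zs : List ℕ} (hzs : zs.Nodup) : ∀ W : World L,
    (∀ W' : World L, (∀ χ : Fml S, (∀ z ∈ zs, (z, 1) ∉ χ.fv) → χ ∈ W → χ ∈ W') →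
      (∀ z ∈ zs, W'.val (.var (z, 1)) = 0) → φ ∈ W') → assignZero zs φ ∈ W := by
  induction zs with
  | nil => exact fun W h => h W (fun _ _ h => h) (by simp)
  | cons z zs ih =>
    rw [List.nodup_cons] at hzs
    refine fun W h => W.box_assign_intro (Set.notMem_empty _) fun W₁ h1 hz => ih hzs.2 W₁ ?_
    refine fun W₂ h2 hzs' => h W₂ (fun χ hχ hm => ?_) ?_
    · exact h2 χ (fun z hz => hχ z (by simp [hz])) (h1 χ (hχ z (by simp)) hm)
    · intro y hy
      rcases List.mem_cons.1 hy with rfl | hy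
      -- The equation for the first variable survives the later assignments because the list has no
      -- repetitions.
      · refine W₂.mem_eq.1 (h2 (.eq (.var (y, 1)) (.const 0)) (fun x hx hm => ?_) (W₁.mem_eq.2 hz))
        rcases hm with hm | hm
        · obtain rfl : x = y := (Prod.ext_iff.1 hm).1
          exact hzs.1 hx
        · exact hm
      · exact hzs' y hy

theorem assignField_intro {φ : Fml S} {sys : ODE S} (hsys : sys.WF) : ∀ W : World L,
    (∀ W' : World L, (∀ χ : Fml S, (∀ i ∈ sys.lhs, (i, 1) ∉ χ.fv) → χ ∈ W → χ ∈ W') →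
      (∀ p ∈ sys, W'.val (.var (p.1, 1)) = W'.val p.2) → φ ∈ W') → assignField sys φ ∈ W := by
  induction sys with
  | nil => exact fun W h => h W (fun _ _ h => h) (by simp)
  | cons p sys ih =>
    have hnd := List.nodup_cons.1 hsys.1
    have hp : ∀ i, ((i, 1) : Var) ∉ p.2.fv := fun i hi => by
      simpa using (hsys.2 p (by simp)).snd_eq_zero _ hi
    refine fun W h => W.box_assign_intro (hp _) fun W₁ h1 hz =>
      ih ⟨hnd.2, fun q hq => hsys.2 q (by simp [hq])⟩ W₁ ?_
    refine fun W₂ h2 hzs' => h W₂ (fun χ hχ hm => ?_) ?_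
    · exact h2 χ (fun i hi => hχ i (List.mem_cons_of_mem _ hi))
        (h1 χ (hχ p.1 (List.mem_cons_self ..)) hm)
    · intro q hq
      rcases List.mem_cons.1 hq with rfl | hq
      · refine W₂.mem_eq.1 (h2 (.eq (.var (q.1, 1)) q.2) (fun i hi hm => ?_) (W₁.mem_eq.2 hz))
        rcases hm with hm | hm
        · exact hnd.1 ((Prod.ext_iff.1 hm).1 ▸ hi)
        · exact hp i hm
      · exact hzs' q hq

/-- The differential axioms follow the recursion that defines the Lie derivative. At a variable the
value of its differential variable is the right-hand side of its equation, or `0` for a parameter.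
-/
theorem val_diff (W : World L) {sys : ODE S} (h1 : ∀ p ∈ sys, W.val (.var (p.1, 1)) = W.val p.2)
    {zs : List ℕ} (h2 : ∀ z ∈ zs, W.val (.var (z, 1)) = 0) {e : Term S} (he : e.DiffFree)
    (hv : ∀ v ∈ e.fv, v.1 ∈ sys.lhs ∨ v.1 ∈ zs) : W.val (.diff e) = W.val (lie L sys e) := by
  induction e with
  | var v =>
    obtain ⟨n, m⟩ := v
    obtain rfl : m = 0 := he
    rw [W.mem_eq.1 (W.mem_of_provable .diffVar), lie]
    rcases sys.field_cases n with ⟨p, hp, rfl, h⟩ | ⟨hn, h⟩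
    · rw [h]; exact h1 p hp
    · rw [h]; exact h2 n ((hv (n, 0) rfl).resolve_left hn)
  | const c => exact W.mem_eq.1 (W.mem_of_provable .diffConst)
  | add a b iha ihb =>
    rw [W.mem_eq.1 (W.mem_of_provable .diffAdd), lie, val_add, val_add,
      iha he.1 fun v h => hv v (Or.inl h), ihb he.2 fun v h => hv v (Or.inr h)]
  | mul a b iha ihb =>
    rw [W.mem_eq.1 (W.mem_of_provable .diffMul), lie, val_add, val_add, val_mul, val_mul, val_mul,
      val_mul, iha he.1 fun v h => hv v (Or.inl h), ihb he.2 fun v h => hv v (Or.inr h)]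
  | app h args ih =>
    rw [W.mem_eq.1 (W.mem_of_provable .diffApp), lie, val_sum, val_sum, List.map_ofFn,
      List.map_ofFn]
    congr 2
    funext i
    simp [ih i (he i) fun v h => hv v (Set.mem_iUnion.2 ⟨i, h⟩)]
  | diff e _ => exact he.elim

/-! ## Differential equations -/

theorem Acc.mem_dom {W W' : World L} {sys : ODE S} {Q : SA S} (hsys : sys.WF) (hQ : Q.DiffFree)
    (h : W.Acc (.ode sys Q) W') : Q.toFml ∈ W' :=
  h _ (W.mem_of_provable (.DW hsys hQ))

/-- `DMP` in terms of worlds. Taking `R` to be `Q` strengthened by a proved invariant gives the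
effect of a differential cut. -/
theorem box_of_dom (W : World L) {sys : ODE S} {Q R : SA S} (hsys : sys.WF) (hQ : Q.DiffFree)
    (hR : R.DiffFree) (h : ∀ W' : World L, W.Acc (.ode sys Q) W' → R.toFml ∈ W') {P : Fml S}
    (hP : Fml.box (.ode sys R) P ∈ W) : Fml.box (.ode sys Q) P ∈ W := by
  have := W.mem_of_provable (Derivable.DMP (L := L) (Γ := []) (P := P) hsys hQ hR)
  simp only [mem_imp] at this
  exact this (W.mem_box.2 fun W' hW' => W'.mem_imp.2 fun _ => h W' hW') hP

theorem box_of_dom_imp (W : World L) {sys : ODE S} {Q R : SA S} (hsys : sys.WF) (hQ : Q.DiffFree)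
    (hR : R.DiffFree) (h : ∀ W' : World L, Q.toFml ∈ W' → R.toFml ∈ W') {P : Fml S}
    (hP : Fml.box (.ode sys R) P ∈ W) : Fml.box (.ode sys Q) P ∈ W :=
  W.box_of_dom hsys hQ hR (fun W' hW' => h W' (hW'.mem_dom hsys hQ)) hP

theorem dia_of_dom (W : World L) {sys : ODE S} {Q R : SA S} (hsys : sys.WF) (hQ : Q.DiffFree)
    (hR : R.DiffFree) (h : ∀ W' : World L, W.Acc (.ode sys Q) W' → R.toFml ∈ W') {P : Fml S}
    (hP : Fml.dia (.ode sys Q) P ∈ W) : Fml.dia (.ode sys R) P ∈ W := by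
  have hd := fun Q => W.mem_of_provable
    (Derivable.diamond (L := L) (Γ := []) (α := .ode sys Q) (φ := P))
  simp only [mem_iff, mem_not] at hd
  rw [hd] at hP ⊢
  exact fun hn => hP (W.box_of_dom hsys hQ hR h hn)

theorem dia_and (W : World L) {sys : ODE S} {Q R : SA S} (hsys : sys.WF) (hQ : Q.DiffFree)
    (hR : R.DiffFree) {P : Fml S} (h : Fml.dia (.ode sys Q) P ∈ W)
    (h' : Fml.dia (.ode sys R) P ∈ W) : Fml.dia (.ode sys (.and Q R)) P ∈ W := by
  have := W.mem_of_provable (Derivable.Uniq (L := L) (Γ := []) (P := P) hsys hQ hR)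
  rw [mem_iff, mem_and] at this
  exact this.2 ⟨h, h'⟩

theorem mem_box_ode (W : World L) {sys : ODE S} {Q : SA S} (hsys : sys.WF) (hQ : Q.DiffFree)
    {P : Fml S} (hP : ∀ i ∈ sys.lhs, (i, 1) ∉ P.fv) :
    Fml.box (.ode sys Q) P ∈ W ↔ (Q.toFml ∈ W → P ∈ W ∧ Fml.box (.ode sys Q) P ∈ W) := by
  have := W.mem_of_provable (Derivable.DX (L := L) (Γ := []) (P := P) hsys hQ hP)
  simpa only [mem_iff, mem_imp, mem_and] using this

theorem exists_paramsOf (sys : ODE S) (e : Term S) : ∃ zs : List ℕ, zs.Nodup ∧ ParamsOf sys e zs := by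
  classical
  refine ⟨((e.fv_finite.toFinset.image Prod.fst).filter (· ∉ sys.lhs)).toList,
    Finset.nodup_toList _, fun z hz => ?_, fun v hv => ?_⟩
  · simp only [Finset.mem_toList, Finset.mem_filter] at hz
    exact hz.2
  · by_cases h : v.1 ∈ sys.lhs
    · exact Or.inl h
    · refine Or.inr ?_
      simp only [Finset.mem_toList, Finset.mem_filter, Finset.mem_image, Set.Finite.mem_toFinset]
      exact ⟨⟨v, hv, rfl⟩, h⟩

/-- Along a differential equation, differentials are Lie derivatives. -/
theorem box_assignZero_intro (W : World L) {sys : ODE S} {Q : SA S} (hsys : sys.WF)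
    (hQ : Q.DiffFree) {e : Term S} (he : e.DiffFree) {zs : List ℕ} (hnd : zs.Nodup)
    (hzs : ParamsOf sys e zs) {χ φ : Fml S} (hχ : ∀ i, ((i, 1) : Var) ∉ χ.fv)
    (h : ∀ W' : World L, Q.toFml ∈ W' → χ ∈ W')
    (hφ : ∀ W' : World L, W'.val (.diff e) = W'.val (lie L sys e) → χ ∈ W' → φ ∈ W') :
    Fml.box (.ode sys Q) (assignZero zs φ) ∈ W := by
  rw [W.mem_iff.1 (W.mem_of_provable (.DE hsys hQ))]
  refine W.mem_box.2 fun W₁ h1 => assignField_intro hsys W₁ fun W₂ h2 hf =>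
    assignZero_intro hnd W₂ fun W₃ h3 hz => hφ W₃ (W₃.val_diff (fun p hp => ?_) hz he hzs.2) ?_
  -- Parameters do not evolve, so setting their differential variables to `0` does not destroy the
  -- equations `x' = f` supplied by `DE`.
  · refine W₃.mem_eq.1 (h3 (.eq (.var (p.1, 1)) p.2) (fun z hz hm => ?_) (W₂.mem_eq.2 (hf p hp)))
    rcases hm with hm | hm
    · exact hzs.1 z hz ((Prod.ext_iff.1 hm).1.symm ▸ ODE.mem_lhs hp :)
    · simpa using (hsys.2 p hp).snd_eq_zero _ hm
  · exact h3 χ (fun z _ => hχ z) (h2 χ (fun i _ => hχ i) (h W₁ (h1.mem_dom hsys hQ)))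

theorem notMem_fv_lie {sys : ODE S} (hsys : sys.WF) {e : Term S} (he : e.DiffFree) (i : ℕ) :
    ((i, 1) : Var) ∉ (lie L sys e).fv := fun h => by
  simpa using (hsys.lie_diffFree he).snd_eq_zero _ h

/-- Differential invariants for `e ≥ 0`. -/
theorem box_ge (W : World L) {sys : ODE S} {Q : SA S} (hsys : sys.WF) (hQ : Q.DiffFree)
    {e : Term S} (he : e.DiffFree) (h : ∀ W' : World L, Q.toFml ∈ W' → 0 ≤ W'.val (lie L sys e))
    (h0 : 0 ≤ W.val e) : Fml.box (.ode sys Q) (.ge e (.const 0)) ∈ W := by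
  obtain ⟨zs, hnd, hzs⟩ := exists_paramsOf sys e
  have h1 := W.mem_of_provable (Derivable.DIge (L := L) (Γ := []) hsys hQ he hzs)
  rw [mem_imp, mem_iff, mem_imp] at h1
  refine (h1 (W.box_assignZero_intro hsys hQ he hnd hzs (χ := .ge (lie L sys e) (.const 0))
    (fun i hi => ?_) h ?_)).2 fun _ => h0
  · exact hi.elim (notMem_fv_lie hsys he i) id
  · intro W' hd hm
    rw [mem_ge] at hm ⊢
    rwa [hd]

/-- Differential invariants for `e = 0`. -/
theorem box_eq (W : World L) {sys : ODE S} {Q : SA S} (hsys : sys.WF) (hQ : Q.DiffFree)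
    {e : Term S} (he : e.DiffFree) (h : ∀ W' : World L, Q.toFml ∈ W' → W'.val (lie L sys e) = 0)
    (h0 : W.val e = 0) : Fml.box (.ode sys Q) (.eq e (.const 0)) ∈ W := by
  obtain ⟨zs, hnd, hzs⟩ := exists_paramsOf sys e
  have h1 := W.mem_of_provable (Derivable.DIeq (L := L) (Γ := []) hsys hQ he hzs)
  rw [mem_imp, mem_iff, mem_imp] at h1
  refine (h1 (W.box_assignZero_intro hsys hQ he hnd hzs (χ := .eq (lie L sys e) (.const 0))
    (fun i hi => ?_) (fun W' hW' => W'.mem_eq.2 (h W' hW')) ?_)).2 fun _ => W.mem_eq.2 h0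
  · exact hi.elim (notMem_fv_lie hsys he i) id
  · intro W' hd hm
    rw [mem_eq] at hm ⊢
    rwa [hd]

end World

/-! ## Fresh variables and ghosts -/

/-- The formula `∃ x, x = c` is provable with witness `c`; as `x` is fresh for the sequent, it can
serve as its own eigenvariable. This is how initial values of ghosts and clocks are prescribed. -/
theorem derivable_of_fresh_eq {Γ : List (Fml S)} {φ : Fml S} {x : Var} {c : Term S}
    (hc : x ∉ c.fv) (hΓ : ∀ χ ∈ Γ, x ∉ χ.fv) (hφ : x ∉ φ.fv)
    (h : Derivable L (.eq (.var x) c :: Γ) φ) : Derivable L Γ φ := by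
  have hs := c.subst_eq_self (σ := single x c) fun v hv => single_of_ne fun h => hc (h ▸ hv)
  refine .cut (ψ := .ex x (.eq (.var x) c)) (.exR (e := c) ⟨trivial, hs.2⟩ ?_)
    (.exL (y := x) ?_ hΓ (by simp [Fml.fv]) hφ ?_)
  · rw [Fml.subst, Term.subst, single_self, hs.1]
    exact derivable_of_forall_world fun W _ => W.eq_refl c
  · rw [single_var]; exact (Fml.subst_var _).2
  · rwa [single_var, (Fml.subst_var _).1]

/-- A fresh scalar linear ghost `y' = a y + b` with the initial value `c`. -/
theorem derivable_box_of_ghost {Γ : List (Fml S)} {sys : ODE S} {Q : SA S} {P : Fml S} {y : ℕ}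
    {a b : Term S} (c : ℚ) (hsys : sys.WF) (hQ : Q.DiffFree) (ha : a.DiffFree) (hb : b.DiffFree)
    (hy : y ∉ sys.lhs) (hy' : (y, 0) ∉ sys.rhsFv ∪ Q.fv ∪ a.fv ∪ b.fv ∪ P.fv) (hP : (y, 1) ∉ P.fv)
    (hΓ : ∀ χ ∈ Γ, (y, 0) ∉ χ.fv)
    (h : Derivable L (.eq (.var (y, 0)) (.const c) :: Γ)
      (.box (.ode (sys ++ [(y, .add (.mul a (.var (y, 0))) b)]) Q) P)) :
    Derivable L Γ (.box (.ode sys Q) P) := by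
  have hfv : (y, 0) ∉ (Fml.box (.ode sys Q) P).fv := by
    simp only [Set.mem_union, not_or] at hy'
    simp [Fml.fv, Prog.fv, hy, hy']
  refine derivable_of_fresh_eq (c := .const c) (Set.notMem_empty _) hΓ hfv ?_
  have hex : Derivable L (.eq (.var (y, 0)) (.const c) :: Γ)
      (.ex (y, 0) (.box (.ode (sys ++ [(y, .add (.mul a (.var (y, 0))) b)]) Q) P)) := by
    refine .exR (e := .var (y, 0)) ?_ ?_
    · rw [single_var]; exact (Fml.subst_var _).2
    · rwa [single_var, (Fml.subst_var _).1]
  refine .cut hex (derivable_of_forall_world fun W hW => ?_)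
  have := W.mem_of_provable (Derivable.DGex (L := L) (Γ := []) hsys hQ ha hb hy hy' hP)
  exact (W.mem_iff.1 this).2 (hW _ (by simp))

theorem exists_fresh (l : List ℕ) {A : Set Var} (hA : A.Finite) :
    ∃ y : ℕ, y ∉ l ∧ (y, 0) ∉ A := by
  classical
  obtain ⟨y, hy⟩ := Infinite.exists_notMem_finset (l.toFinset ∪ hA.toFinset.image Prod.fst)
  simp only [Finset.mem_union, List.mem_toFinset, Finset.mem_image, Set.Finite.mem_toFinset,
    not_or, not_exists, not_and] at hy
  exact ⟨y, hy.1, fun h => hy.2 _ h rfl⟩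

theorem ODE.rhsFv_append (sys : ODE S) (y : ℕ) (a : Term S) :
    ODE.rhsFv (sys ++ [(y, a)]) = sys.rhsFv ∪ a.fv := by
  ext v
  simp only [ODE.rhsFv, List.mem_append, List.mem_singleton, Set.mem_ofPred_eq, Set.mem_union]
  constructor
  · rintro ⟨p, hp | rfl, h⟩
    exacts [Or.inl ⟨p, hp, h⟩, Or.inr h]
  · rintro (⟨p, hp, h⟩ | h)
    exacts [⟨p, Or.inl hp, h⟩, ⟨_, Or.inr rfl, h⟩]

/-! ## Darboux inequalities and differential radical invariants -/

namespace World

/-- The Darboux step after the ghosts `y' = - g y` and `z' = g z / 2` have been introduced. -/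
theorem box_of_darboux_ghosts (W : World L) {sys : ODE S} {Q : SA S} (hsys : sys.WF)
    (hQ : Q.DiffFree) {p g : Term S} (hp : p.DiffFree) {y z : ℕ}
    (hy : ∀ W' : World L, W'.val (lie L sys (.var (y, 0))) = - W'.val g * W'.val (.var (y, 0)))
    (hz : ∀ W' : World L,
      2 * W'.val (lie L sys (.var (z, 0))) = W'.val g * W'.val (.var (z, 0)))
    (h : ∀ W' : World L, Q.toFml ∈ W' → W'.val g * W'.val p ≤ W'.val (lie L sys p))
    (hy0 : W.val (.var (y, 0)) = 1) (hz0 : W.val (.var (z, 0)) = 1) (h0 : 0 ≤ W.val p) :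
    Fml.box (.ode sys Q) (.ge p (.const 0)) ∈ W := by
  have hyd : Term.DiffFree (S := S) (.var (y, 0)) := rfl
  have hzd : Term.DiffFree (S := S) (.var (z, 0)) := rfl
  have hR : SA.DiffFree (.and Q (.gt (.var (y, 0)) (.const 0))) := ⟨hQ, hyd, trivial⟩
  -- The ghosts are chosen so that `(y z²)' = -g y z² + 2 y z (g z / 2) = 0`. Thus `y z² = 1` is
  -- invariant, which forces `y > 0`.
  have h1 : Fml.box (.ode sys Q) (.eq (.add (.mul (.var (y, 0))
      (.mul (.var (z, 0)) (.var (z, 0)))) (.const (-1))) (.const 0)) ∈ W := by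
    refine W.box_eq hsys hQ ⟨⟨hyd, hzd, hzd⟩, trivial⟩ (fun W' _ => ?_) ?_
    · simp only [lie, val_add, val_mul, val_zero] at hy hz ⊢
      linear_combination (W'.val (.var (z, 0)) * W'.val (.var (z, 0))) * hy W' +
        (W'.val (.var (y, 0)) * W'.val (.var (z, 0))) * hz W'
    · simp [hy0, hz0]
  -- The integrating factor: `(p y)' = (p' - g p) y`, which is nonnegative where `y > 0`.
  have h2 : Fml.box (.ode sys (.and Q (.gt (.var (y, 0)) (.const 0))))
      (.ge (.mul p (.var (y, 0))) (.const 0)) ∈ W := by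
    refine W.box_ge hsys hR ⟨hp, hyd⟩ (fun W' hW' => ?_) ?_
    · simp only [SA.toFml, mem_and, mem_gt, val_zero] at hW'
      rw [lie, val_add, val_mul, val_mul, hy W']
      nlinarith [h W' hW'.1, mul_le_mul_of_nonneg_right (h W' hW'.1) hW'.2.le]
    · simpa [hy0] using h0
  refine W.box_of_dom (R := .and Q (.gt (.var (y, 0)) (.const 0))) hsys hQ
    hR (fun W' hW' => ?_) (W.mem_box.2 fun W' hW' => ?_)
  · have h3 := hW' _ h1
    simp only [mem_eq, val_add, val_mul, val_zero, val_neg_one] at h3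
    simp only [SA.toFml, mem_and, mem_gt, val_zero]
    refine ⟨hW'.mem_dom hsys hQ, ?_⟩
    by_contra hn
    push Not at hn
    nlinarith [mul_nonneg (neg_nonneg.2 hn) (mul_self_nonneg (W'.val (.var (z, 0))))]
  · have h3 := hW' _ h2
    have h4 := hW'.mem_dom hsys hR
    simp only [SA.toFml, mem_and, mem_gt, mem_ge, val_mul, val_zero] at h3 h4 ⊢
    exact nonneg_of_mul_nonneg_left h3 h4.2

/-- Darboux inequalities: `p ≥ 0` is invariant if `p' ≥ g p`. -/
theorem box_ge_of_darboux (W : World L) {sys : ODE S} {Q : SA S} (hsys : sys.WF) (hQ : Q.DiffFree)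
    {p g : Term S} (hp : p.DiffFree) (hg : g.DiffFree)
    (h : ∀ W' : World L, Q.toFml ∈ W' → W'.val g * W'.val p ≤ W'.val (lie L sys p))
    (h0 : 0 ≤ W.val p) : Fml.box (.ode sys Q) (.ge p (.const 0)) ∈ W := by
  have hfin := ((sys.rhsFv_finite.union Q.fv_finite).union p.fv_finite).union g.fv_finite
  obtain ⟨y, hyl, hyf⟩ := exists_fresh sys.lhs hfin
  obtain ⟨z, hzl, hzf⟩ := exists_fresh (y :: sys.lhs) hfin
  simp only [Set.mem_union, not_or, List.mem_cons] at hyf hzf hzl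
  have hprime : ∀ n : ℕ, ((n, 1) : Var) ∉ p.fv := fun n hn => by
    simpa using hp.snd_eq_zero _ hn
  have h1 : (Term.DiffFree (S := S) (.mul (.const (-1)) g)) := ⟨trivial, hg⟩
  -- The coefficients `-g` and `g / 2` make `y z²` constant. Both ghosts are started at `1`, so this
  -- constant is `1`.
  have h2 : (Term.DiffFree (S := S) (.mul (.const (1 / 2)) g)) := ⟨trivial, hg⟩
  have hsys₁ := hsys.append (a := .add (.mul (.mul (.const (-1)) g) (.var (y, 0))) (.const 0))
    hyl ⟨⟨h1, rfl⟩, trivial⟩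
  have hzl₁ : z ∉ ODE.lhs
      (sys ++ [(y, .add (.mul (.mul (.const (-1)) g) (.var (y, 0))) (.const 0))]) := by
    rw [ODE.lhs_append]; simpa using ⟨hzl.2, hzl.1⟩
  have hsys₂ := hsys₁.append (a := .add (.mul (.mul (.const (1 / 2)) g) (.var (z, 0))) (.const 0))
    hzl₁ ⟨⟨h2, rfl⟩, trivial⟩
  refine W.mem_of_derivable (Γ := [.ge p (.const 0)]) ?_ (by simpa using h0)
  refine derivable_box_of_ghost (y := y) (a := .mul (.const (-1)) g) (b := .const 0) 1
    hsys hQ h1 trivial hyl (by simp [Term.fv, Fml.fv, hyf]) (by simp [Term.fv, Fml.fv, hprime])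
    (by simp [Term.fv, Fml.fv, hyf]) ?_
  refine derivable_box_of_ghost (y := z) (a := .mul (.const (1 / 2)) g) (b := .const 0) 1
    hsys₁ hQ h2 trivial hzl₁ ?_ (by simp [Term.fv, Fml.fv, hprime])
    (by simp [Term.fv, Fml.fv, hzf, hzl]) ?_
  · rw [ODE.rhsFv_append]; simp [Term.fv, Fml.fv, hzf, hzl]
  refine derivable_of_forall_world fun W' hW' => ?_
  simp only [List.mem_cons, List.not_mem_nil, or_false, forall_eq_or_imp, forall_eq, mem_eq,
    mem_ge, val_one, val_zero] at hW'
  refine W'.box_of_darboux_ghosts (g := g) (y := y) (z := z) hsys₂ hQ hp (fun V => ?_)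
    (fun V => ?_) (fun V hV => ?_) hW'.2.1 hW'.1 hW'.2.2
  · rw [lie, hsys₂.field_of_mem
      (List.mem_append_left _ (List.mem_append_right _ (List.mem_singleton_self _)))]
    simp
  · rw [lie, hsys₂.field_of_mem (List.mem_append_right _ (List.mem_singleton_self _))]
    have h3 : V.val (.const (1 / 2)) + V.val (.const (1 / 2)) = 1 := by
      rw [← val_const_add]; norm_num
    simp only [val_add, val_mul, val_zero]
    linear_combination (V.val g * V.val (.var (z, 0))) * h3
  · rw [lie_append hp hzf.1.2, lie_append hp hyf.1.2]
    exact h V hV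

end World

theorem sum_map_range_eq {M : Type*} [AddCommMonoid M] (f : ℕ → M) (n : ℕ) :
    ((List.range n).map f).sum = ∑ i ∈ Finset.range n, f i := by
  induction n with
  | zero => simp
  | succ n ih => simp [List.range_succ, Finset.sum_range_succ, ih]

theorem lie_sum (sys : ODE S) (l : List (Term S)) :
    lie L sys (Term.sum l) = Term.sum (l.map (lie L sys)) := by
  induction l with
  | nil => rfl
  | cons a l ih => rw [Term.sum, lie, ih]; rfl

/-- The growth bound for the squared norm of a solution of a companion system. -/
theorem companion_bound {F : Type*} [CommRing F] [LinearOrder F] [IsStrictOrderedRing F]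
    (x c : ℕ → F) (n : ℕ) :
    ∑ i ∈ Finset.range n, 2 * (x i * x (i + 1)) +
        2 * (x n * ∑ i ∈ Finset.range (n + 1), c i * x i) ≤
      (3 + ∑ i ∈ Finset.range (n + 1), c i * c i) * ∑ i ∈ Finset.range (n + 1), x i * x i := by
  set A := ∑ i ∈ Finset.range (n + 1), x i * x i
  set C := ∑ i ∈ Finset.range (n + 1), c i * c i
  have hC : 0 ≤ C := Finset.sum_nonneg fun i _ => mul_self_nonneg _
  have hn : x n * x n ≤ A :=
    Finset.single_le_sum (f := fun i => x i * x i) (fun i _ => mul_self_nonneg _) (by simp)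
  have h1 : ∑ i ∈ Finset.range n, 2 * (x i * x (i + 1)) ≤ 2 * A := by
    calc _ ≤ ∑ i ∈ Finset.range n, (x i * x i + x (i + 1) * x (i + 1)) :=
          Finset.sum_le_sum fun i _ => by nlinarith [mul_self_nonneg (x i - x (i + 1))]
      _ = ∑ i ∈ Finset.range n, x i * x i + ∑ i ∈ Finset.range n, x (i + 1) * x (i + 1) :=
          Finset.sum_add_distrib
      -- The two sums are `A` without its last and without its first summand.
      _ ≤ 2 * A := by
          have h3 : A = _ := Finset.sum_range_succ (fun i => x i * x i) n
          have h4 : A = _ := Finset.sum_range_succ' (fun i => x i * x i) n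
          nlinarith [mul_self_nonneg (x 0), mul_self_nonneg (x n)]
  -- Termwise `2 c x y ≤ c² x² + y²`. This adds one `A` to the `2 A` of the shifted products, whence
  -- the constant `3`; the remaining `C (x n)²` is at most `C A`.
  have h2 : 2 * (x n * ∑ i ∈ Finset.range (n + 1), c i * x i) ≤ C * (x n * x n) + A := by
    rw [Finset.mul_sum, Finset.mul_sum, Finset.sum_mul, ← Finset.sum_add_distrib]
    exact Finset.sum_le_sum fun i _ => by nlinarith [mul_self_nonneg (c i * x n - x i)]
  nlinarith [mul_le_mul_of_nonneg_left hn hC]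

namespace World

/-- Differential radical invariants. -/
theorem box_eq_of_radical (W : World L) {sys : ODE S} {Q : SA S} (hsys : sys.WF) (hQ : Q.DiffFree)
    {n : ℕ} {d c : ℕ → Term S} (hd : ∀ i ≤ n, (d i).DiffFree) (hc : ∀ i ≤ n, (c i).DiffFree)
    (h1 : ∀ (W' : World L), ∀ i < n, W'.val (lie L sys (d i)) = W'.val (d (i + 1)))
    (h2 : ∀ (W' : World L), W'.val (lie L sys (d n)) =
      ∑ i ∈ Finset.range (n + 1), W'.val (c i) * W'.val (d i))
    (h0 : ∀ i ≤ n, W.val (d i) = 0) :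
    ∀ i ≤ n, Fml.box (.ode sys Q) (.eq (d i) (.const 0)) ∈ W := by
  set sq : Term S := Term.sum ((List.range (n + 1)).map fun i => .mul (d i) (d i)) with hsq
  set g : Term S := .add (.const (3 : ℕ))
    (Term.sum ((List.range (n + 1)).map fun i => .mul (c i) (c i))) with hg
  have hvsq : ∀ W' : World L, W'.val sq =
      ∑ i ∈ Finset.range (n + 1), W'.val (d i) * W'.val (d i) := fun W' => by
    rw [hsq, val_sum, List.map_map, sum_map_range_eq]; rfl
  have hvg : ∀ W' : World L, W'.val g =
      3 + ∑ i ∈ Finset.range (n + 1), W'.val (c i) * W'.val (c i) := fun W' => by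
    rw [hg, val_add, val_sum, List.map_map, sum_map_range_eq, val_const_natCast]; rfl
  have hlie : ∀ W' : World L, W'.val (lie L sys sq) =
      ∑ i ∈ Finset.range n, 2 * (W'.val (d i) * W'.val (d (i + 1))) + 2 * (W'.val (d n) *
        ∑ i ∈ Finset.range (n + 1), W'.val (c i) * W'.val (d i)) := fun W' => by
    rw [hsq, lie_sum, val_sum, List.map_map, List.map_map, sum_map_range_eq,
      Finset.sum_range_succ]
    congr 1
    · refine Finset.sum_congr rfl fun i hi => ?_
      simp only [Function.comp, lie, val_add, val_mul, h1 W' i (Finset.mem_range.1 hi)]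
      ring
    · simp only [Function.comp, lie, val_add, val_mul, h2 W']
      ring
  have hsqd : sq.DiffFree := Term.sum_diffFree fun e he => by
    obtain ⟨i, hi, rfl⟩ := List.mem_map.1 he
    have := hd i (Nat.lt_succ_iff.1 (List.mem_range.1 hi))
    exact ⟨this, this⟩
  have hgd : g.DiffFree := ⟨trivial, Term.sum_diffFree fun e he => by
    obtain ⟨i, hi, rfl⟩ := List.mem_map.1 he
    have := hc i (Nat.lt_succ_iff.1 (List.mem_range.1 hi))
    exact ⟨this, this⟩⟩
  -- The growth bound says `(-sq)' ≥ g (-sq)`, and `sq` is `0` now. The Darboux inequality keeps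
  -- `-sq ≥ 0`, and a sum of squares that is at most `0` has only zero summands. Passing to the
  -- squared norm turns an argument about a vector into one that needs only scalar ghosts.
  have key : Fml.box (.ode sys Q) (.ge (.mul (.const (-1)) sq) (.const 0)) ∈ W := by
    refine W.box_ge_of_darboux (g := g) hsys hQ ⟨trivial, hsqd⟩ hgd (fun W' _ => ?_) ?_
    · simp only [lie, val_add, val_mul, val_zero, val_neg_one]
      rw [hlie, hvg, hvsq]
      have := companion_bound (fun i => W'.val (d i)) (fun i => W'.val (c i)) n
      linarith
    · rw [val_mul, val_neg_one, hvsq, Finset.sum_eq_zero fun i hi => ?_]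
      · simp
      · rw [h0 i (Nat.lt_succ_iff.1 (Finset.mem_range.1 hi)), mul_zero]
  refine fun i hi => W.mem_box.2 fun W' hW' => W'.mem_eq.2 ?_
  have h3 := hW' _ key
  rw [mem_ge, val_mul, val_neg_one, val_zero, hvsq] at h3
  have h4 := Finset.single_le_sum (f := fun i => W'.val (d i) * W'.val (d i))
    (fun i _ => mul_self_nonneg _) (Finset.mem_range.2 (Nat.lt_succ_iff.2 hi))
  exact mul_self_eq_zero.1 (le_antisymm (by linarith) (mul_self_nonneg _))

end World

/-! ## Systems with a clock -/

/-- The system contains the clock `t' = 1` (up to provable equality), so it evolves everywhere. -/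
structure ODE.HasClock (L : ExtLang S) (sys : ODE S) (t : ℕ) : Prop where
  wf : sys.WF
  evolves : sys.LocallyEvolves L
  val_lie : ∀ W : World L, W.val (lie L sys (.var (t, 0))) = 1

/-- The clock is written `t' = 0 * t + 1` so that it has the form of a scalar linear ghost. Its
right-hand side is never `0`, which makes `Cont` applicable even if `sys` has equilibria. -/
theorem ODE.WF.hasClock_append {sys : ODE S} (hsys : sys.WF) {t : ℕ} (ht : t ∉ sys.lhs) :
    ODE.HasClock L
      (sys ++ [(t, .add (.mul (.const 0) (.var (t, 0))) (.const 1))]) t := by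
  have hwf := hsys.append (a := .add (.mul (.const 0) (.var (t, 0))) (.const 1)) ht
    ⟨⟨trivial, rfl⟩, trivial⟩
  refine ⟨hwf, fun ω => ⟨_, List.mem_append_right _ (List.mem_singleton_self _), ?_⟩, fun W => ?_⟩
  · simp [Term.sem]
  · rw [lie, hwf.field_of_mem (List.mem_append_right _ (List.mem_singleton_self _))]
    simp

/-- The formula `t = 0`. -/
def clockZero (t : ℕ) : Fml S := .eq (.var (t, 0)) (.const 0)

theorem exists_fresh_list (l : List ℕ) {A : Set Var} (hA : A.Finite) (n : ℕ) :
    ∃ ys : List ℕ, ys.length = n ∧ ys.Nodup ∧ ∀ y ∈ ys, y ∉ l ∧ (y, 0) ∉ A := by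
  induction n with
  | zero => exact ⟨[], by simp⟩
  | succ n ih =>
    obtain ⟨ys, h1, h2, h3⟩ := ih
    obtain ⟨y, hy, hy'⟩ := exists_fresh (ys ++ l) hA
    simp only [List.mem_append, not_or] at hy
    exact ⟨y :: ys, by simp [h1], List.nodup_cons.2 ⟨hy.1, h2⟩, by simpa [hy.2, hy'] using h3⟩

theorem derivable_of_fresh_eqs {Γ : List (Fml S)} {φ : Fml S} : ∀ {l : List (ℕ × ℕ)},
    (l.map Prod.snd).Nodup → (∀ p ∈ l, ∀ q ∈ l, p.1 ≠ q.2) →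
    (∀ p ∈ l, ∀ χ ∈ Γ, (p.2, 0) ∉ χ.fv) → (∀ p ∈ l, (p.2, 0) ∉ φ.fv) →
    Derivable L (l.map (fun p => .eq (.var (p.2, 0)) (.var (p.1, 0))) ++ Γ) φ →
    Derivable L Γ φ
  | [], _, _, _, _, h => h
  | p :: l, hnd, hne, hΓ, hφ, h => by
    rw [List.map_cons, List.nodup_cons] at hnd
    refine derivable_of_fresh_eqs (l := l) hnd.2
      (fun q hq r hr => hne q (by simp [hq]) r (by simp [hr]))
      (fun q hq => hΓ q (by simp [hq])) (fun q hq => hφ q (by simp [hq]))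
      (derivable_of_fresh_eq (x := (p.2, 0)) (c := .var (p.1, 0)) ?_ ?_ (hφ p (by simp)) h)
    · simpa [Term.fv] using (hne p (by simp) p (by simp)).symm
    · intro χ hχ
      rcases List.mem_append.1 hχ with hχ | hχ
      · obtain ⟨q, hq, rfl⟩ := List.mem_map.1 hχ
        have h1 : p.2 ≠ q.2 := fun h => hnd.1 (h ▸ List.mem_map_of_mem hq)
        have h2 := (hne q (by simp [hq]) p (by simp)).symm
        simp [Fml.fv, Term.fv, h1, h2]
      · exact hΓ p (by simp) χ hχ

namespace World

theorem mem_conj (W : World L) : ∀ {l : List (Fml S)}, Fml.conj l ∈ W ↔ ∀ φ ∈ l, φ ∈ W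
  | [] => by simp [Fml.conj, Fml.tru]
  | [φ] => by simp [Fml.conj]
  | φ :: ψ :: l => by
    rw [Fml.conj, mem_and, mem_conj W]
    simp

theorem mem_disj (W : World L) : ∀ {l : List (Fml S)}, Fml.disj l ∈ W ↔ ∃ φ ∈ l, φ ∈ W
  | [] => by simpa [Fml.disj] using W.fls_notMem
  | [φ] => by simp [Fml.disj]
  | φ :: ψ :: l => by
    rw [Fml.disj, mem_or, mem_disj W]
    simp

theorem mem_dia_not (W : World L) {α : Prog S} {φ : Fml S} :
    Fml.dia α (.not φ) ∈ W ↔ Fml.box α φ ∉ W := by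
  rw [mem_dia, mem_box]
  simp

theorem mem_clockZero (W : World L) {t : ℕ} :
    clockZero (S := S) t ∈ W ↔ W.val (.var (t, 0)) = 0 := W.mem_eq

variable {sys : ODE S} {t : ℕ}

/-- If no time can pass, every term keeps the value zero. -/
theorem box_eq_of_stuck (W : World L) (hc : sys.HasClock L t) {Q : SA S} (hQ : Q.DiffFree)
    (ht : W.val (.var (t, 0)) = 0) (hbox : Fml.box (.ode sys Q) (clockZero t) ∈ W) {u : Term S}
    (hu : u.DiffFree) (h0 : W.val u = 0) : Fml.box (.ode sys Q) (.eq u (.const 0)) ∈ W := by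
  have hR : SA.DiffFree (.and Q (.eq (.var (t, 0)) (.const 0))) := ⟨hQ, rfl, trivial⟩
  -- Subtract the first order Taylor term: the derivative of `u - t * u'` is `-t * u''`, which is
  -- `0` where `t = 0`. So `u - t * u'` stays `0`, and with `t = 0` this gives `u = 0`.
  have h1 : Fml.box (.ode sys (.and Q (.eq (.var (t, 0)) (.const 0))))
      (.eq (.add u (.mul (.const (-1)) (.mul (.var (t, 0)) (lie L sys u)))) (.const 0)) ∈ W := by
    refine W.box_eq hc.wf hR ⟨hu, trivial, rfl, hc.wf.lie_diffFree hu⟩ (fun V hV => ?_) ?_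
    · simp only [SA.toFml, mem_and, mem_eq, val_zero] at hV
      have h2 := hc.val_lie V
      rw [lie] at h2
      simp only [lie, val_add, val_mul, val_zero, val_neg_one, h2, hV.2]
      ring
    · simp [ht, h0]
  refine W.box_of_dom hc.wf hQ hR (fun V hV => ?_) (W.mem_box.2 fun V hV => ?_)
  · simp only [SA.toFml, mem_and]
    exact ⟨hV.mem_dom hc.wf hQ, hV _ hbox⟩
  · have h2 := hV.mem_dom hc.wf hR
    have h3 := hV _ h1
    simp only [SA.toFml, mem_and, mem_eq, val_add, val_mul, val_zero] at h2 h3 ⊢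
    simpa [h2.2] using h3

/-- Continuous existence: `p > 0` stays true until the clock has moved. -/
theorem dia_gt (W : World L) (hc : sys.HasClock L t) (ht : W.val (.var (t, 0)) = 0) {p : Term S}
    (hp : p.DiffFree) (h0 : 0 < W.val p) :
    Fml.dia (.ode sys (.gt p (.const 0))) (.not (clockZero t)) ∈ W := by
  have hQ : SA.DiffFree (.gt p (.const 0)) := ⟨hp, trivial⟩
  -- Fresh copies `ys` of the evolving variables record the initial point for `Cont`. They also
  -- avoid `t`, so that the clock formula does not mention them.
  obtain ⟨ys, hlen, hnd, hys⟩ := exists_fresh_list (t :: sys.lhs)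
    (sys.rhsFv_finite.union p.fv_finite) sys.lhs.length
  have hzip : ∀ q ∈ sys.lhs.zip ys, q.1 ∈ sys.lhs ∧ q.2 ∈ ys := fun q hq => List.of_mem_zip hq
  simp only [List.mem_cons, Set.mem_union, not_or] at hys
  refine W.mem_of_derivable (Γ := [clockZero t, .gt p (.const 0)]) (derivable_of_fresh_eqs
    (l := sys.lhs.zip ys) ?_ (fun q hq r hr h => ?_) (fun q hq => ?_) (fun q hq => ?_) ?_) ?_
  · rw [List.map_snd_zip hlen.le]; exact hnd
  · exact (hys _ (hzip r hr).2).1.2 (h ▸ (hzip q hq).1)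
  · have := hys _ (hzip q hq).2
    simp [clockZero, Fml.fv, Term.fv, this]
  · have := hys _ (hzip q hq).2
    simp [clockZero, Fml.fv, Prog.fv, SA.fv, Term.fv, this]
  · refine derivable_of_forall_world fun W hW => ?_
    have ht : W.val (.var (t, 0)) = 0 := W.mem_clockZero.1 (hW _ (by simp))
    have h0 : 0 < W.val p := W.mem_gt.1 (hW _ (by simp))
    have hxy : ∀ q ∈ sys.lhs.zip ys, W.val (.var (q.2, 0)) = W.val (.var (q.1, 0)) :=
      fun q hq => W.mem_eq.1 (hW _ (List.mem_append_left _ (List.mem_map_of_mem hq)))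
    have hvec : ∀ V : World L, Fml.vecEq sys.lhs ys ∈ V ↔
        ∀ q ∈ sys.lhs.zip ys, V.val (.var (q.1, 0)) = V.val (.var (q.2, 0)) := fun V => by
      rw [Fml.vecEq, mem_conj, ← List.map_uncurry_zip_eq_zipWith]
      exact List.forall_mem_map.trans (forall₂_congr fun q _ => V.mem_eq)
    have hcont := W.mem_of_provable (Derivable.Cont (L := L) (Γ := []) (e := p) hc.wf hc.evolves
      hp hlen hnd fun y hy => ⟨(hys y hy).1.2, by
        simpa only [Set.mem_union, not_or] using (hys y hy).2⟩)
    rw [mem_imp, mem_iff] at hcont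
    have hd := (hcont ((hvec W).2 fun q hq => (hxy q hq).symm)).2 (W.mem_gt.2 h0)
    obtain ⟨V, hV, hV'⟩ := W.mem_dia.1 hd
    rw [mem_dia_not]
    -- `Cont` only says that some evolving variable leaves its initial value. If the clock never
    -- left `0`, every difference between a variable and its copy would remain `0`, a contradiction.
    intro hbox
    refine V.mem_not.1 hV' ((hvec V).2 fun q hq => ?_)
    have h1 := hV _ (W.box_eq_of_stuck hc hQ ht hbox
      (u := .add (.var (q.1, 0)) (.mul (.const (-1)) (.var (q.2, 0)))) ⟨rfl, trivial, rfl⟩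
      (by simp [hxy q hq]))
    simp only [mem_eq, val_add, val_mul, val_neg_one, val_zero] at h1
    linear_combination h1
  · simpa [mem_clockZero, ht] using h0

/-! ### Properties that can be maintained until the clock has moved -/

/-- Some evolution domain that implies `X` can be followed until the clock has moved. -/
def Sustains (W : World L) (sys : ODE S) (t : ℕ) (X : World L → Prop) : Prop :=
  ∃ R : SA S, R.DiffFree ∧ Fml.dia (.ode sys R) (.not (clockZero t)) ∈ W ∧
    ∀ V : World L, R.toFml ∈ V → X V

theorem Sustains.mono {W : World L} {X Y : World L → Prop} (h : W.Sustains sys t X)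
    (hXY : ∀ V, X V → Y V) : W.Sustains sys t Y := by
  obtain ⟨R, h1, h2, h3⟩ := h
  exact ⟨R, h1, h2, fun V hV => hXY V (h3 V hV)⟩

/-- `Uniq` intersects the two domains: there is only one solution, so the run that obeys the one
constraint also obeys the other. -/
theorem Sustains.and {W : World L} (hsys : sys.WF) {X Y : World L → Prop}
    (h : W.Sustains sys t X) (h' : W.Sustains sys t Y) : W.Sustains sys t fun V => X V ∧ Y V := by
  obtain ⟨R, h1, h2, h3⟩ := h
  obtain ⟨R', h1', h2', h3'⟩ := h'
  refine ⟨.and R R', ⟨h1, h1'⟩, W.dia_and hsys h1 h1' h2 h2', fun V hV => ?_⟩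
  rw [SA.toFml, mem_and] at hV
  exact ⟨h3 V hV.1, h3' V hV.2⟩

theorem sustains_gt (W : World L) (hc : sys.HasClock L t) (ht : W.val (.var (t, 0)) = 0)
    {p : Term S} (hp : p.DiffFree) (h0 : 0 < W.val p) :
    W.Sustains sys t fun V => 0 < V.val p :=
  ⟨.gt p (.const 0), ⟨hp, trivial⟩, W.dia_gt hc ht hp h0, fun V hV => V.mem_gt.1 hV⟩

theorem sustains_forall_mem (W : World L) (hc : sys.HasClock L t) (ht : W.val (.var (t, 0)) = 0)
    {α : Type*} {l : List α} {X : α → World L → Prop} (h : ∀ a ∈ l, W.Sustains sys t (X a)) :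
    W.Sustains sys t fun V => ∀ a ∈ l, X a V := by
  induction l with
  -- The empty conjunction still requires that the clock can move; the always true domain `1 > 0`
  -- provides this.
  | nil => exact (W.sustains_gt hc ht (p := .const 1) trivial (by simp)).mono (by simp)
  | cons a l ih =>
    refine ((h a (by simp)).and hc.wf (ih fun b hb => h b (by simp [hb]))).mono fun V hV => ?_
    simpa using hV

/-- A quantity that is nonnegative now and has nonnegative derivative stays nonnegative. -/
theorem Sustains.ge {W : World L} (hsys : sys.WF) {X : World L → Prop} (h : W.Sustains sys t X)
    {p : Term S} (hp : p.DiffFree) (h0 : 0 ≤ W.val p)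
    (hX : ∀ V, X V → 0 ≤ V.val (lie L sys p)) :
    W.Sustains sys t fun V => X V ∧ 0 ≤ V.val p := by
  obtain ⟨R, h1, h2, h3⟩ := h
  have hR : SA.DiffFree (.and R (.ge p (.const 0))) := ⟨h1, hp, trivial⟩
  refine ⟨_, hR, W.dia_of_dom hsys h1 hR (fun V hV => ?_) h2, fun V hV => ?_⟩
  · exact V.mem_and.2 ⟨hV.mem_dom hsys h1,
      hV _ (W.box_ge hsys h1 hp (fun V hV => hX V (h3 V hV)) h0)⟩
  · rw [SA.toFml, mem_and] at hV
    exact ⟨h3 V hV.1, V.mem_ge.1 hV.2⟩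

theorem Sustains.clock_nonneg {W : World L} (hc : sys.HasClock L t)
    (ht : W.val (.var (t, 0)) = 0) {X : World L → Prop} (h : W.Sustains sys t X) :
    W.Sustains sys t fun V => X V ∧ 0 ≤ V.val (.var (t, 0)) :=
  h.ge hc.wf rfl ht.ge fun V _ => by rw [hc.val_lie]; exact zero_le_one

/-- What is sustained is true somewhere in every domain that can be followed. -/
theorem Sustains.exists_world {W : World L} (hsys : sys.WF) {X : World L → Prop}
    (h : W.Sustains sys t X) {Q : SA S} (hQ : Q.DiffFree)
    (hd : Fml.box (.ode sys Q) (clockZero t) ∉ W) :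
    ∃ V : World L, Q.toFml ∈ V ∧ X V ∧ V.val (.var (t, 0)) ≠ 0 := by
  obtain ⟨R, h1, h2, h3⟩ := h
  have hR : SA.DiffFree (.and Q R) := ⟨hQ, h1⟩
  obtain ⟨V, hV, hV'⟩ := W.mem_dia.1 (W.dia_and hsys hQ h1 (W.mem_dia_not.2 hd) h2)
  have := hV.mem_dom hsys hR
  rw [SA.toFml, mem_and] at this
  rw [mem_not, mem_clockZero] at hV'
  exact ⟨V, this.1, h3 V this.2, hV'⟩

/-- The sustaining domain implies `Q`, so safety along `Q` transfers to it, and it contains a world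
at which the clock has moved. -/
theorem Sustains.exists_acc {W : World L} (hsys : sys.WF) {X : World L → Prop}
    (h : W.Sustains sys t X) {Q : SA S} (hQ : Q.DiffFree) (hXQ : ∀ V, X V → Q.toFml ∈ V)
    {P : Fml S} (hP : Fml.box (.ode sys Q) P ∈ W) :
    ∃ V : World L, X V ∧ P ∈ V ∧ V.val (.var (t, 0)) ≠ 0 := by
  obtain ⟨R, h1, h2, h3⟩ := h
  obtain ⟨V, hV, hV'⟩ := W.mem_dia.1 h2
  rw [mem_not, mem_clockZero] at hV'
  exact ⟨V, h3 V (hV.mem_dom hsys h1),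
    hV _ (W.box_of_dom_imp hsys h1 hQ (fun V hV => hXQ V (h3 V hV)) hP), hV'⟩

end World

/-! ## Progress along a differential equation -/

/-- The term `tᵏ / k!`. -/
def clockPow (t : ℕ) : ℕ → Term S
  | 0 => .const 1
  | k + 1 => .mul (.const (1 / ((k + 1 : ℕ) : ℚ))) (.mul (.var (t, 0)) (clockPow t k))

theorem clockPow_diffFree (t k : ℕ) : (clockPow (S := S) t k).DiffFree := by
  induction k with
  | zero => trivial
  | succ k ih => exact ⟨trivial, rfl, ih⟩

namespace World

variable {sys : ODE S} {t : ℕ}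

theorem natCast_mul_val_inv (W : World L) (k : ℕ) :
    ((k + 1 : ℕ) : W.Val) * W.val (.const (1 / ((k + 1 : ℕ) : ℚ))) = 1 := by
  have : ((k + 1 : ℕ) : ℚ) ≠ 0 := by positivity
  rw [← val_const_natCast, ← val_const_mul, mul_one_div_cancel this, val_one]

theorem val_clockPow_succ (W : World L) (k : ℕ) :
    ((k + 1 : ℕ) : W.Val) * W.val (clockPow t (k + 1)) =
      W.val (.var (t, 0)) * W.val (clockPow t k) := by
  rw [clockPow, val_mul, val_mul, ← mul_assoc, natCast_mul_val_inv, one_mul]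

theorem val_lie_clockPow (W : World L) (hc : sys.HasClock L t) (k : ℕ) :
    W.val (lie L sys (clockPow t (k + 1))) = W.val (clockPow t k) := by
  have h1 := hc.val_lie W
  rw [lie] at h1
  induction k with
  | zero => simp [clockPow, lie, h1]
  | succ k ih =>
    rw [clockPow]
    simp only [lie, val_add, val_mul, val_zero, h1, ih]
    have h2 := W.natCast_mul_val_inv (k + 1)
    have h3 := W.val_clockPow_succ (t := t) k
    push_cast at h2 h3 ⊢
    linear_combination (W.val (clockPow t (k + 1))) * h2 -
      W.val (.const (1 / ((k : ℚ) + 1 + 1))) * h3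

theorem val_clockPow_pos (W : World L) (h : 0 < W.val (.var (t, 0))) (k : ℕ) :
    0 < W.val (clockPow t k) := by
  induction k with
  | zero => simp [clockPow]
  | succ k ih =>
    have h1 := W.val_clockPow_succ (t := t) k
    refine pos_of_mul_pos_right (a := ((k + 1 : ℕ) : W.Val)) ?_ (Nat.cast_nonneg _)
    rw [h1]
    exact mul_pos h ih

theorem val_clockPow_succ_eq_zero (W : World L) (h : W.val (.var (t, 0)) = 0) (k : ℕ) :
    W.val (clockPow t (k + 1)) = 0 := by
  simp [clockPow, h]

/-- A Taylor bound by repeated integration: a lower bound for `d 1` is one for the derivative of `d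
0`. The exponent is `m + 1` because `d m` is merely positive and need not exceed any fixed positive
rational, whereas `d m - t > 0` holds at `t = 0` and is an open condition. -/
theorem sustains_ge_clockPow (W : World L) (hc : sys.HasClock L t)
    (ht : W.val (.var (t, 0)) = 0) {m : ℕ} : ∀ {d : ℕ → Term S}, (∀ i, (d i).DiffFree) →
    (∀ (V : World L) i, V.val (lie L sys (d i)) = V.val (d (i + 1))) →
    (∀ i < m, W.val (d i) = 0) → 0 < W.val (d m) →
    W.Sustains sys t fun V => V.val (clockPow t (m + 1)) ≤ V.val (d 0) := by
  have hdf : ∀ {e : Term S} (k : ℕ), e.DiffFree →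
      (Term.add e (.mul (.const (-1)) (clockPow t k))).DiffFree :=
    fun k he => ⟨he, trivial, clockPow_diffFree t k⟩
  induction m with
  | zero =>
    intro d hd hl _ hm
    refine (W.sustains_gt hc ht (hdf 1 (hd 0)) ?_).mono fun V hV => ?_
    · simpa [W.val_clockPow_succ_eq_zero ht] using hm
    · simp only [val_add, val_mul, val_neg_one] at hV
      linarith
  | succ m ih =>
    intro d hd hl h0 hm
    have h1 := ih (d := fun i => d (i + 1)) (fun i => hd _) (fun V i => hl V _)
      (fun i hi => h0 _ (by omega)) hm
    -- Since `(t^(m+2)/(m+2)!)' = t^(m+1)/(m+1)!`, the induction hypothesis for the shifted sequence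
    -- makes the derivative of `d 0 - t^(m+2)/(m+2)!` nonnegative; the difference is `0` now.
    refine (h1.ge hc.wf (hdf (m + 2) (hd 0)) ?_ fun V hV => ?_).mono fun V hV => ?_
    · simp [W.val_clockPow_succ_eq_zero ht, h0]
    · rw [lie, val_add, lie, val_add, val_mul, val_mul, val_neg_one, V.val_lie_clockPow hc, hl]
      simp only [lie, val_zero]
      linarith
    · have := hV.2
      simp only [val_add, val_mul, val_neg_one] at this
      linarith

/-- If the first nonvanishing derivative is positive, the term is positive once the clock moves. -/
theorem sustains_pos (W : World L) (hc : sys.HasClock L t) (ht : W.val (.var (t, 0)) = 0) {m : ℕ}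
    {d : ℕ → Term S} (hd : ∀ i, (d i).DiffFree)
    (hl : ∀ (V : World L) i, V.val (lie L sys (d i)) = V.val (d (i + 1)))
    (h0 : ∀ i < m, W.val (d i) = 0) (hm : 0 < W.val (d m)) :
    W.Sustains sys t fun V => V.val (.var (t, 0)) ≠ 0 → 0 < V.val (d 0) :=
  ((W.sustains_ge_clockPow hc ht hd hl h0 hm).clock_nonneg hc ht).mono fun V hV hne =>
    (V.val_clockPow_pos (lt_of_le_of_ne hV.2 hne.symm) _).trans_le hV.1

theorem sustains_neg (W : World L) (hc : sys.HasClock L t) (ht : W.val (.var (t, 0)) = 0) {m : ℕ}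
    {d : ℕ → Term S} (hd : ∀ i, (d i).DiffFree)
    (hl : ∀ (V : World L) i, V.val (lie L sys (d i)) = V.val (d (i + 1)))
    (h0 : ∀ i < m, W.val (d i) = 0) (hm : W.val (d m) < 0) :
    W.Sustains sys t fun V => V.val (.var (t, 0)) ≠ 0 → V.val (d 0) < 0 := by
  refine (W.sustains_pos hc ht (m := m) (d := fun i => .mul (.const (-1)) (d i))
    (fun i => ⟨trivial, hd i⟩) (fun V i => ?_) (fun i hi => ?_) ?_).mono fun V hV hne => ?_
  · simp [lie, hl]
  · simp [h0 i hi]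
  · simpa using hm
  · simpa using hV hne

/-- A term that is nonnegative now is sustained to be so as long as the clock has not moved. -/
theorem sustains_nonneg_of_clock_eq_zero (W : World L) (hc : sys.HasClock L t)
    (ht : W.val (.var (t, 0)) = 0) {u : Term S} (hu : u.DiffFree) (h0 : 0 ≤ W.val u) :
    W.Sustains sys t fun V => V.val (.var (t, 0)) = 0 → 0 ≤ V.val u := by
  rcases h0.lt_or_eq with h0 | h0
  · exact (W.sustains_gt hc ht hu h0).mono fun V hV _ => hV.le
  -- For `u = 0` now, the barrier `t - u²` starts at `0` with derivative `1 - 2 u u' = 1`, so it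
  -- remains nonnegative locally. Where `t = 0` it gives `u² ≤ 0`.
  · set p : Term S := .add (.var (t, 0)) (.mul (.const (-1)) (.mul u u)) with hp
    have hpd : p.DiffFree := ⟨rfl, trivial, hu, hu⟩
    refine ((W.sustains_gt hc ht (hc.wf.lie_diffFree hpd) ?_).ge hc.wf hpd ?_
      fun V hV => hV.le).mono fun V hV hV' => ?_
    · have h1 := hc.val_lie W
      rw [lie] at h1
      simp [hp, lie, h1, ← h0]
    · simp [hp, ht, ← h0]
    · have := hV.2
      simp only [hp, val_add, val_mul, val_neg_one, hV', zero_add, neg_one_mul,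
        Left.nonneg_neg_iff] at this
      exact (mul_self_eq_zero.1 (le_antisymm this (mul_self_nonneg _))).ge

end World

/-! ## Progress formulas and radicals in a world -/

/-- The first nonvanishing member of a sequence is positive if and only if the members satisfy
the conditions that make up a progress formula. -/
theorem progress_conditions_iff {F : Type*} [Zero F] [LinearOrder F] (x : ℕ → F) {N : ℕ}
    (hN : 1 ≤ N) :
    (∀ i < N, (∀ j < i, x j = 0) → if i + 1 < N then 0 ≤ x i else 0 < x i) ↔
      ∃ m < N, (∀ j < m, x j = 0) ∧ 0 < x m := by
  constructor
  · intro h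
    have hne : ∃ i, i < N ∧ x i ≠ 0 := by
      by_contra hn
      push Not at hn
      -- If all members vanished, the strict condition at the last index would read `0 < 0`.
      have := h (N - 1) (by omega) fun j hj => hn j (by omega)
      rw [if_neg (by omega), hn _ (by omega)] at this
      exact lt_irrefl _ this
    classical
    have hz : ∀ j < Nat.find hne, x j = 0 := fun j hj => by
      have := Nat.find_min hne hj
      push Not at this
      exact this (hj.trans (Nat.find_spec hne).1)
    obtain ⟨h1, h2⟩ := Nat.find_spec hne
    refine ⟨_, h1, hz, ?_⟩
    have := h _ h1 hz
    split_ifs at this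
    · exact lt_of_le_of_ne this h2.symm
    · exact this
  · rintro ⟨m, hm, hz, hpos⟩ i hi hzi
    rcases lt_trichotomy i m with him | rfl | him
    · rw [if_pos (by omega), hz i him]
    · split_ifs
      exacts [hpos.le, hpos]
    · exact absurd (hzi m him) hpos.ne'

namespace World

variable {sys sys' : ODE S} {t : ℕ}

theorem mem_lieZeros (W : World L) {N : ℕ} {e : Term S} :
    lieZeros L sys N e ∈ W ↔ ∀ i < N, W.val (lieIter L sys i e) = 0 := by
  simp [lieZeros, mem_conj]

theorem mem_radical (W : World L) (R : DiffRadicals L) {e : Term S} :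
    R.radical sys e ∈ W ↔ ∀ i < R.rank sys e, W.val (lieIter L sys i e) = 0 :=
  W.mem_lieZeros

theorem mem_progressGt (W : World L) (R : DiffRadicals L) {e : Term S}
    (hN : 1 ≤ R.rank sys e) : R.progressGt sys e ∈ W ↔
      ∃ m < R.rank sys e, (∀ j < m, W.val (lieIter L sys j e) = 0) ∧
        0 < W.val (lieIter L sys m e) := by
  rw [← progress_conditions_iff (fun i => W.val (lieIter L sys i e)) hN, DiffRadicals.progressGt,
    mem_conj]
  simp only [List.mem_map, List.mem_range, forall_exists_index, and_imp,
    forall_apply_eq_imp_iff₂]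
  refine forall₂_congr fun i hi => ?_
  have hc : (if i + 1 < R.rank sys e then Fml.ge (lieIter L sys i e) (.const 0)
      else .gt (lieIter L sys i e) (.const 0)) ∈ W ↔
      if i + 1 < R.rank sys e then 0 ≤ W.val (lieIter L sys i e)
      else 0 < W.val (lieIter L sys i e) := by
    split_ifs <;> simp
  by_cases h0 : i = 0
  · rw [if_pos h0, hc]
    subst h0
    simp
  · rw [if_neg h0, mem_imp, mem_lieZeros, hc]

theorem eq_zero_or_first_ne_zero (W : World L) (R : DiffRadicals L) {e : Term S} :
    R.radical sys e ∈ W ∨ ∃ m < R.rank sys e,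
      (∀ j < m, W.val (lieIter L sys j e) = 0) ∧ W.val (lieIter L sys m e) ≠ 0 := by
  classical
  rw [mem_radical, or_iff_not_imp_left]
  intro h
  push Not at h
  obtain ⟨h1, h2⟩ := Nat.find_spec h
  exact ⟨_, h1, fun j hj => by
    have := Nat.find_min h hj
    push Not at this
    exact this (hj.trans h1), h2⟩

theorem radical_or_progressGt_or_neg (W : World L) (R : DiffRadicals L) {e : Term S}
    (hN : 1 ≤ R.rank sys e) : R.radical sys e ∈ W ∨ R.progressGt sys e ∈ W ∨
      ∃ m < R.rank sys e, (∀ j < m, W.val (lieIter L sys j e) = 0) ∧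
        W.val (lieIter L sys m e) < 0 := by
  rcases W.eq_zero_or_first_ne_zero R (sys := sys) (e := e) with h | ⟨m, hm, hz, hne⟩
  · exact Or.inl h
  · rcases hne.lt_or_gt with h | h
    · exact Or.inr (Or.inr ⟨m, hm, hz, h⟩)
    · exact Or.inr (Or.inl ((W.mem_progressGt R hN).2 ⟨m, hm, hz, h⟩))

end World

/-- `sys'` contains the clock `t`, and agrees with `sys` on terms in which `t` does not occur. -/
structure ClockExtension (L : ExtLang S) (sys sys' : ODE S) (t : ℕ) : Prop where
  wf : sys.WF
  hasClock : sys'.HasClock L t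
  lie_eq : ∀ e : Term S, e.DiffFree → (t, 0) ∉ e.fv → lie L sys' e = lie L sys e
  fresh : (t, 0) ∉ sys.rhsFv

namespace ClockExtension

variable {sys sys' : ODE S} {t : ℕ}

theorem val_lie (h : ClockExtension L sys sys' t) {e : Term S} (he : e.DiffFree)
    (het : (t, 0) ∉ e.fv) (V : World L) (i : ℕ) :
    V.val (lie L sys' (lieIter L sys i e)) = V.val (lieIter L sys (i + 1) e) := by
  rw [lieIter_succ, h.lie_eq _ (h.wf.lieIter_diffFree he i)
    (h.wf.notMem_fv_lieIter he het h.fresh i)]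

/-- Differential radical invariants along the extended system. -/
theorem box_of_radical (h : ClockExtension L sys sys' t) (R : DiffRadicals L) (W : World L)
    {Q : SA S} (hQ : Q.DiffFree) {e : Term S} (he : e.DiffFree) (het : (t, 0) ∉ e.fv)
    (hr : R.radical sys e ∈ W) : Fml.box (.ode sys' Q) (.eq e (.const 0)) ∈ W := by
  have hN := R.rank_pos sys e h.wf he
  rw [W.mem_radical] at hr
  -- The Lie derivatives of order `0` to `N - 1` form a companion system, closed at the last index
  -- by the radical identity for order `N`.
  refine W.box_eq_of_radical (n := R.rank sys e - 1) (d := fun i => lieIter L sys i e)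
    (c := R.cof sys e) h.hasClock.wf hQ (fun i _ => h.wf.lieIter_diffFree he i)
    (fun i hi => R.cof_diffFree sys e i h.wf he (by omega)) (fun V i _ => h.val_lie he het V i)
    (fun V => ?_) (fun i hi => hr i (by omega)) 0 (Nat.zero_le _)
  have h1 := V.mem_eq.1 (V.mem_of_provable (R.identity sys e h.wf he))
  rw [World.val_sum, List.map_map, sum_map_range_eq] at h1
  rw [h.val_lie he het, Nat.sub_add_cancel hN, h1]
  rfl

theorem sustains_eq (h : ClockExtension L sys sys' t) (R : DiffRadicals L) (W : World L)
    (ht : W.val (.var (t, 0)) = 0) {e : Term S} (he : e.DiffFree) (het : (t, 0) ∉ e.fv)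
    (hr : R.radical sys e ∈ W) :
    W.Sustains sys' t fun V => V.val e = 0 := by
  -- The domain `1 > 0` is no restriction: the clock can move in it, and the invariant `e = 0` holds
  -- along it.
  have hT : SA.DiffFree (S := S) (.gt (.const 1) (.const 0)) := ⟨trivial, trivial⟩
  have hR : SA.DiffFree (.eq e (.const 0)) := ⟨he, trivial⟩
  exact ⟨_, hR, W.dia_of_dom h.hasClock.wf hT hR
    (fun V hV => hV _ (h.box_of_radical R W hT he het hr))
    (W.dia_gt h.hasClock ht (p := .const 1) trivial (by simp)), fun V hV => V.mem_eq.1 hV⟩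

theorem sustains_gt (h : ClockExtension L sys sys' t) (R : DiffRadicals L) (W : World L)
    (ht : W.val (.var (t, 0)) = 0) {e : Term S} (he : e.DiffFree) (het : (t, 0) ∉ e.fv)
    (hp : R.progressGt sys e ∈ W) :
    W.Sustains sys' t fun V => V.val (.var (t, 0)) ≠ 0 → 0 < V.val e := by
  obtain ⟨m, -, hz, hm⟩ := (W.mem_progressGt R (R.rank_pos sys e h.wf he)).1 hp
  exact W.sustains_pos h.hasClock ht (h.wf.lieIter_diffFree he) (h.val_lie he het) hz hm

theorem sustains_ge (h : ClockExtension L sys sys' t) (R : DiffRadicals L) (W : World L)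
    (ht : W.val (.var (t, 0)) = 0) {e : Term S} (he : e.DiffFree) (het : (t, 0) ∉ e.fv)
    (hp : R.progressGe sys e ∈ W) :
    W.Sustains sys' t fun V => V.val (.var (t, 0)) ≠ 0 → 0 ≤ V.val e := by
  rcases W.mem_or.1 hp with hp | hp
  · exact (h.sustains_gt R W ht he het hp).mono fun V hV hne => (hV hne).le
  · exact (h.sustains_eq R W ht he het hp).mono fun V hV _ => hV.ge

/-- The trichotomy for the first nonvanishing Lie derivative: if neither `Prog_>` nor `Rad` holds,
it exists and is negative. So failure of a progress formula is as informative as its truth. -/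
theorem sustains_lt (h : ClockExtension L sys sys' t) (R : DiffRadicals L) (W : World L)
    (ht : W.val (.var (t, 0)) = 0) {e : Term S} (he : e.DiffFree) (het : (t, 0) ∉ e.fv)
    (hp : R.progressGe sys e ∉ W) :
    W.Sustains sys' t fun V => V.val (.var (t, 0)) ≠ 0 → V.val e < 0 := by
  rw [DiffRadicals.progressGe, W.mem_or, not_or] at hp
  obtain ⟨m, -, hz, hm⟩ := ((W.radical_or_progressGt_or_neg R
    (R.rank_pos sys e h.wf he)).resolve_left hp.2).resolve_left hp.1
  exact W.sustains_neg h.hasClock ht (h.wf.lieIter_diffFree he) (h.val_lie he het) hz hm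

theorem sustains_le (h : ClockExtension L sys sys' t) (R : DiffRadicals L) (W : World L)
    (ht : W.val (.var (t, 0)) = 0) {e : Term S} (he : e.DiffFree) (het : (t, 0) ∉ e.fv)
    (hp : R.progressGt sys e ∉ W) :
    W.Sustains sys' t fun V => V.val (.var (t, 0)) ≠ 0 → V.val e ≤ 0 := by
  by_cases hr : R.radical sys e ∈ W
  · exact (h.sustains_eq R W ht he het hr).mono fun V hV _ => hV.le
  · refine (h.sustains_lt R W ht he het ?_).mono fun V hV hne => (hV hne).le
    rw [DiffRadicals.progressGe, W.mem_or]
    exact not_or.2 ⟨hp, hr⟩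

theorem sustains_ne (h : ClockExtension L sys sys' t) (R : DiffRadicals L) (W : World L)
    (ht : W.val (.var (t, 0)) = 0) {e : Term S} (he : e.DiffFree) (het : (t, 0) ∉ e.fv)
    (hr : R.radical sys e ∉ W) :
    W.Sustains sys' t fun V => V.val (.var (t, 0)) ≠ 0 → V.val e ≠ 0 := by
  by_cases hp : R.progressGt sys e ∈ W
  · exact (h.sustains_gt R W ht he het hp).mono fun V hV hne => (hV hne).ne'
  · refine (h.sustains_lt R W ht he het ?_).mono fun V hV hne => (hV hne).ne
    rw [DiffRadicals.progressGe, W.mem_or]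
    exact not_or.2 ⟨hp, hr⟩

end ClockExtension

/-! ## Normal forms -/

namespace World

theorem mem_nf (W : World L) {D : NF S} : D.toFml ∈ W ↔
    ∃ c ∈ D, (∀ u ∈ c.1, 0 ≤ W.val u) ∧ ∀ u ∈ c.2, 0 < W.val u := by
  simp only [NF.toFml, mem_disj, List.mem_map, exists_exists_and_eq_and, mem_and, mem_conj,
    forall_exists_index, and_imp, forall_apply_eq_imp_iff₂, mem_ge, mem_gt, val_zero]

theorem mem_progress (W : World L) (R : DiffRadicals L) (sys : ODE S) {D : NF S} :
    R.progress sys D ∈ W ↔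
      ∃ c ∈ D, (∀ u ∈ c.1, R.progressGe sys u ∈ W) ∧ ∀ u ∈ c.2, R.progressGt sys u ∈ W := by
  simp only [DiffRadicals.progress, mem_disj, List.mem_map, exists_exists_and_eq_and, mem_and,
    mem_conj, forall_exists_index, and_imp, forall_apply_eq_imp_iff₂]

end World

theorem NF.IsNormalFormOf.mem_iff {D : NF S} {Q : SA S} (h : D.IsNormalFormOf L Q)
    (W : World L) : Q.toFml ∈ W ↔ D.toFml ∈ W :=
  W.mem_iff.1 (W.mem_of_provable h.2)

theorem NF.isNormalFormOf_of_forall_world {D : NF S} {Q : SA S} (hD : D.DiffFree)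
    (h : ∀ W : World L, Q.toFml ∈ W ↔ D.toFml ∈ W) : D.IsNormalFormOf L Q :=
  ⟨hD, derivable_of_forall_world fun W _ => W.mem_iff.2 (h W)⟩

/-- The difference of two terms. -/
def Term.sub (a b : Term S) : Term S := .add a (.mul (.const (-1)) b)

@[simp] theorem World.val_sub (W : World L) (a b : Term S) :
    W.val (a.sub b) = W.val a - W.val b := by
  simp [Term.sub, sub_eq_add_neg]

theorem Term.DiffFree.sub {a b : Term S} (ha : a.DiffFree) (hb : b.DiffFree) :
    (a.sub b).DiffFree := ⟨ha, trivial, hb⟩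

theorem NF.exists_or {D E : NF S} (hD : D.DiffFree) (hE : E.DiffFree) : ∃ F : NF S, F.DiffFree ∧
    ∀ W : World L, F.toFml ∈ W ↔ D.toFml ∈ W ∨ E.toFml ∈ W := by
  refine ⟨D ++ E, fun c hc => ?_, fun W => ?_⟩
  · rcases List.mem_append.1 hc with hc | hc
    exacts [hD c hc, hE c hc]
  · simp only [World.mem_nf, List.mem_append, or_and_right, _root_.exists_or]

theorem NF.exists_and {D E : NF S} (hD : D.DiffFree) (hE : E.DiffFree) : ∃ F : NF S, F.DiffFree ∧
    ∀ W : World L, F.toFml ∈ W ↔ D.toFml ∈ W ∧ E.toFml ∈ W := by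
  refine ⟨(D.product E).map fun c => (c.1.1 ++ c.2.1, c.1.2 ++ c.2.2), fun c hc => ?_,
    fun W => ?_⟩
  · obtain ⟨⟨a, b⟩, hab, rfl⟩ := List.mem_map.1 hc
    obtain ⟨ha, hb⟩ := List.mem_product.1 hab
    simp only [List.mem_append]
    exact ⟨fun u hu => hu.elim ((hD a ha).1 u) ((hE b hb).1 u),
      fun u hu => hu.elim ((hD a ha).2 u) ((hE b hb).2 u)⟩
  · simp only [World.mem_nf, List.mem_map]
    constructor
    · rintro ⟨-, ⟨⟨a, b⟩, hab, rfl⟩, h1, h2⟩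
      obtain ⟨ha, hb⟩ := List.mem_product.1 hab
      exact ⟨⟨a, ha, fun u hu => h1 u (List.mem_append_left _ hu),
        fun u hu => h2 u (List.mem_append_left _ hu)⟩, ⟨b, hb,
        fun u hu => h1 u (List.mem_append_right _ hu),
        fun u hu => h2 u (List.mem_append_right _ hu)⟩⟩
    · rintro ⟨⟨a, ha, h1, h2⟩, ⟨b, hb, h3, h4⟩⟩
      refine ⟨_, ⟨(a, b), List.mem_product.2 ⟨ha, hb⟩, rfl⟩, fun u hu => ?_, fun u hu => ?_⟩
      · exact (List.mem_append.1 hu).elim (h1 u) (h3 u)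
      · exact (List.mem_append.1 hu).elim (h2 u) (h4 u)

/-- Normal forms of `Q` and of its negation are built together, so that negation merely exchanges
the two. -/
theorem SA.exists_nf (Q : SA S) (hQ : Q.DiffFree) :
    (∃ D : NF S, D.DiffFree ∧ ∀ W : World L, D.toFml ∈ W ↔ Q.toFml ∈ W) ∧
      ∃ D : NF S, D.DiffFree ∧ ∀ W : World L, D.toFml ∈ W ↔ Q.toFml ∉ W := by
  induction Q with
  | eq a b =>
    refine ⟨⟨[([a.sub b, b.sub a], [])], ?_, fun W => ?_⟩,
      ⟨[([], [a.sub b]), ([], [b.sub a])], ?_, fun W => ?_⟩⟩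
    · simp [NF.DiffFree, hQ.1.sub hQ.2, hQ.2.sub hQ.1]
    · simp [World.mem_nf, SA.toFml, le_antisymm_iff, and_comm]
    · simp [NF.DiffFree, hQ.1.sub hQ.2, hQ.2.sub hQ.1]
    · rw [SA.toFml, World.mem_eq, ← ne_eq, ne_iff_lt_or_gt]
      simp [World.mem_nf, or_comm]
  | ge a b =>
    refine ⟨⟨[([a.sub b], [])], ?_, fun W => ?_⟩, ⟨[([], [b.sub a])], ?_, fun W => ?_⟩⟩
    · simp [NF.DiffFree, hQ.1.sub hQ.2]
    · simp [World.mem_nf, SA.toFml]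
    · simp [NF.DiffFree, hQ.2.sub hQ.1]
    · simp [World.mem_nf, SA.toFml]
  | gt a b =>
    refine ⟨⟨[([], [a.sub b])], ?_, fun W => ?_⟩, ⟨[([b.sub a], [])], ?_, fun W => ?_⟩⟩
    · simp [NF.DiffFree, hQ.1.sub hQ.2]
    · simp [World.mem_nf, SA.toFml]
    · simp [NF.DiffFree, hQ.2.sub hQ.1]
    · simp [World.mem_nf, SA.toFml]
  | not P ih =>
    obtain ⟨h1, D, hD, h2⟩ := ih hQ
    refine ⟨⟨D, hD, fun W => by rw [h2, SA.toFml, World.mem_not]⟩, ?_⟩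
    obtain ⟨D, hD, h2⟩ := h1
    exact ⟨D, hD, fun W => by rw [h2, SA.toFml, World.mem_not, not_not]⟩
  | and P Q ihP ihQ =>
    obtain ⟨⟨D₁, hD₁, h1⟩, ⟨D₂, hD₂, h2⟩⟩ := ihP hQ.1
    obtain ⟨⟨E₁, hE₁, h3⟩, ⟨E₂, hE₂, h4⟩⟩ := ihQ hQ.2
    obtain ⟨F, hF, h5⟩ := NF.exists_and (L := L) hD₁ hE₁
    obtain ⟨G, hG, h6⟩ := NF.exists_or (L := L) hD₂ hE₂
    exact ⟨⟨F, hF, fun W => by rw [h5, h1, h3, SA.toFml, World.mem_and]⟩,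
      ⟨G, hG, fun W => by rw [h6, h2, h4, SA.toFml, World.mem_and, not_and_or]⟩⟩
  | or P Q ihP ihQ =>
    obtain ⟨⟨D₁, hD₁, h1⟩, ⟨D₂, hD₂, h2⟩⟩ := ihP hQ.1
    obtain ⟨⟨E₁, hE₁, h3⟩, ⟨E₂, hE₂, h4⟩⟩ := ihQ hQ.2
    obtain ⟨F, hF, h5⟩ := NF.exists_or (L := L) hD₁ hE₁
    obtain ⟨G, hG, h6⟩ := NF.exists_and (L := L) hD₂ hE₂
    exact ⟨⟨F, hF, fun W => by rw [h5, h1, h3, SA.toFml, World.mem_or]⟩,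
      ⟨G, hG, fun W => by rw [h6, h2, h4, SA.toFml, World.mem_or, not_or]⟩⟩

/-! ## Completeness -/

/-- The terms of a normal form do not contain the variable `v`. -/
def NF.Fresh (v : Var) (D : NF S) : Prop :=
  ∀ c ∈ D, (∀ u ∈ c.1, v ∉ u.fv) ∧ ∀ u ∈ c.2, v ∉ u.fv

namespace ClockExtension

variable {sys sys' : ODE S} {t : ℕ}

/-- If `Rad(e)` failed, `e` would be nonzero once the clock has moved. But `Q` can be followed that
far, and safety demands `e = 0` there. -/
theorem radical_mem (h : ClockExtension L sys sys' t) (R : DiffRadicals L) (W : World L)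
    (ht : W.val (.var (t, 0)) = 0) {e : Term S} (he : e.DiffFree) (het : (t, 0) ∉ e.fv)
    {Q : SA S} (hQ : Q.DiffFree) {D : NF S} (hD : D.IsNormalFormOf L Q) (hDt : D.Fresh (t, 0))
    (hbox : Fml.box (.ode sys' Q) (.eq e (.const 0)) ∈ W) (hQW : Q.toFml ∈ W)
    (hprog : R.progress sys D ∈ W) : R.radical sys e ∈ W := by
  by_contra hr
  have hc := h.hasClock
  obtain ⟨c₀, hc₀, h1, h2⟩ := W.mem_nf.1 ((hD.mem_iff W).1 hQW)
  obtain ⟨c, hcD, h3, h4⟩ := (W.mem_progress R sys).1 hprog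
  have k1 := W.sustains_forall_mem hc ht fun u hu =>
    W.sustains_nonneg_of_clock_eq_zero hc ht ((hD.1 c₀ hc₀).1 u hu) (h1 u hu)
  have k2 := W.sustains_forall_mem hc ht fun u hu =>
    W.sustains_gt hc ht ((hD.1 c₀ hc₀).2 u hu) (h2 u hu)
  have k3 := W.sustains_forall_mem hc ht fun u hu =>
    h.sustains_ge R W ht ((hD.1 c hcD).1 u hu) ((hDt c hcD).1 u hu) (h3 u hu)
  have k4 := W.sustains_forall_mem hc ht fun u hu =>
    h.sustains_gt R W ht ((hD.1 c hcD).2 u hu) ((hDt c hcD).2 u hu) (h4 u hu)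
  have k5 := h.sustains_ne R W ht he het hr
  obtain ⟨V, hV, hV0, hVt⟩ := World.Sustains.exists_acc hc.wf
    (((k1.and hc.wf k2).and hc.wf (k3.and hc.wf k4)).and hc.wf k5) hQ (by
      rintro V ⟨⟨⟨m1, m2⟩, m3, m4⟩, -⟩
      refine (hD.mem_iff V).2 (V.mem_nf.2 ?_)
      -- Two disjuncts of the normal form may be needed. Where `t = 0`, the one true initially is
      -- maintained; where `t ≠ 0`, the one that makes progress holds. The latter may fail
      -- initially, since `Prog_>(u)` allows `u = 0` now.
      by_cases hVt : V.val (.var (t, 0)) = 0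
      · exact ⟨c₀, hc₀, fun u hu => m1 u hu hVt, m2⟩
      · exact ⟨c, hcD, fun u hu => m3 u hu hVt, fun u hu => m4 u hu hVt⟩) hbox
  exact hV.2 hVt (V.mem_eq.1 hV0)

/-- Three cases: outside `Q` the claim is vacuous by `DX`; with progress, `Rad(e)` is invariant;
without progress, `Q` cannot be left running and `e` is frozen at `0`. -/
theorem box_mem (h : ClockExtension L sys sys' t) (R : DiffRadicals L) (W : World L)
    (ht : W.val (.var (t, 0)) = 0) {e : Term S} (he : e.DiffFree) (het : (t, 0) ∉ e.fv)
    {Q : SA S} (hQ : Q.DiffFree) {D : NF S} (hD : D.IsNormalFormOf L Q) (hDt : D.Fresh (t, 0))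
    (h0 : Q.toFml ∈ W → W.val e = 0 ∧ (R.progress sys D ∈ W → R.radical sys e ∈ W)) :
    Fml.box (.ode sys' Q) (.eq e (.const 0)) ∈ W := by
  have hc := h.hasClock
  have hprime : ∀ i ∈ sys'.lhs, ((i, 1) : Var) ∉ (Fml.eq e (.const 0)).fv := fun i _ hi =>
    hi.elim (fun hi => by simpa using he.snd_eq_zero _ hi) id
  by_cases hQW : Q.toFml ∈ W
  swap
  · exact (W.mem_box_ode hc.wf hQ hprime).2 fun h => absurd h hQW
  obtain ⟨he0, hr⟩ := h0 hQW
  by_cases hprog : R.progress sys D ∈ W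
  · exact h.box_of_radical R W hQ he het (hr hprog)
  -- It remains to show that the clock cannot move along `Q`: each disjunct has a conjunct without
  -- progress, whose sign is wrong as soon as `t ≠ 0`.
  refine W.box_eq_of_stuck hc hQ ht ?_ he he0
  have k : ∀ c ∈ D, W.Sustains sys' t fun V => V.val (.var (t, 0)) ≠ 0 →
      ¬ ((∀ u ∈ c.1, 0 ≤ V.val u) ∧ ∀ u ∈ c.2, 0 < V.val u) := by
    intro c hcD
    by_cases h1 : ∀ u ∈ c.1, R.progressGe sys u ∈ W
    · by_cases h2 : ∀ u ∈ c.2, R.progressGt sys u ∈ W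
      · exact absurd ((W.mem_progress R sys).2 ⟨c, hcD, h1, h2⟩) hprog
      · push Not at h2
        obtain ⟨u, hu, hn⟩ := h2
        exact (h.sustains_le R W ht ((hD.1 c hcD).2 u hu) ((hDt c hcD).2 u hu) hn).mono
          fun V hV hne hall => absurd (hall.2 u hu) (hV hne).not_gt
    · push Not at h1
      obtain ⟨u, hu, hn⟩ := h1
      exact (h.sustains_lt R W ht ((hD.1 c hcD).1 u hu) ((hDt c hcD).1 u hu) hn).mono
        fun V hV hne hall => absurd (hall.1 u hu) (hV hne).not_ge
  by_contra hn
  obtain ⟨V, hVQ, hV, hVt⟩ := (W.sustains_forall_mem hc ht k).exists_world hc.wf hQ hn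
  obtain ⟨c, hcD, hcV⟩ := V.mem_nf.1 ((hD.mem_iff V).1 hVQ)
  exact hV c hcD hVt hcV

end ClockExtension

/-! ### Adjoining a fresh clock and the final equivalence -/

theorem ODE.WF.clockExtension {sys : ODE S} (hsys : sys.WF) {t : ℕ} (ht : t ∉ sys.lhs)
    (ht' : (t, 0) ∉ sys.rhsFv) : ClockExtension L sys
      (sys ++ [(t, .add (.mul (.const 0) (.var (t, 0))) (.const 1))]) t :=
  ⟨hsys, hsys.hasClock_append ht, fun _ he het => lie_append he het, ht'⟩

theorem Prog.fv_finite (α : Prog S) : α.fv.Finite := by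
  cases α with
  | ode sys Q =>
    refine (Set.Finite.union ?_ sys.rhsFv_finite).union Q.fv_finite
    refine ((List.finite_toSet sys.lhs).prod (Set.finite_singleton 0)).subset fun v hv => ?_
    exact ⟨hv.1, hv.2⟩
  | assign x e => exact e.fv_finite

theorem Fml.fv_finite (φ : Fml S) : φ.fv.Finite := by
  induction φ with
  | eq a b => exact a.fv_finite.union b.fv_finite
  | ge a b => exact a.fv_finite.union b.fv_finite
  | gt a b => exact a.fv_finite.union b.fv_finite
  | not φ ih => exact ih
  | and φ ψ h1 h2 => exact h1.union h2
  | or φ ψ h1 h2 => exact h1.union h2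
  | all x φ ih => exact ih.sdiff
  | ex x φ ih => exact ih.sdiff
  | box α φ ih => exact α.fv_finite.union ih.sdiff
  | dia α φ ih => exact α.fv_finite.union ih.sdiff

theorem NF.exists_finite_fresh (D : NF S) : ∃ A : Set Var, A.Finite ∧ ∀ v ∉ A, D.Fresh v := by
  refine ⟨⋃ c ∈ {c | c ∈ D}, (⋃ u ∈ {u | u ∈ c.1}, u.fv) ∪ ⋃ u ∈ {u | u ∈ c.2}, u.fv, ?_, ?_⟩
  · exact (List.finite_toSet D).biUnion fun c _ =>
      ((List.finite_toSet c.1).biUnion fun u _ => u.fv_finite).union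
        ((List.finite_toSet c.2).biUnion fun u _ => u.fv_finite)
  · intro v hv c hc
    exact ⟨fun u hu huv => hv (Set.mem_biUnion (x := c) hc (Or.inl
      (Set.mem_biUnion (x := u) hu huv))), fun u hu huv => hv (Set.mem_biUnion (x := c) hc (Or.inr
      (Set.mem_biUnion (x := u) hu huv)))⟩

/-- Adding a scalar linear ghost keeps a safety property. -/
theorem World.box_append_ghost (W : World L) {sys : ODE S} {Q : SA S} {P : Fml S} {y : ℕ}
    {a b : Term S} (hsys : sys.WF) (hQ : Q.DiffFree) (ha : a.DiffFree) (hb : b.DiffFree)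
    (hy : y ∉ sys.lhs) (hy' : (y, 0) ∉ sys.rhsFv ∪ Q.fv ∪ a.fv ∪ b.fv ∪ P.fv) (hP : (y, 1) ∉ P.fv)
    (h : Fml.box (.ode sys Q) P ∈ W) :
    Fml.box (.ode (sys ++ [(y, .add (.mul a (.var (y, 0))) b)]) Q) P ∈ W := by
  have h1 := (W.mem_iff.1 (W.mem_of_provable
    (Derivable.DGall (L := L) (Γ := []) hsys hQ ha hb hy hy' hP))).1 h
  refine W.mem_of_derivable (.allL (Γ := []) (e := .var (y, 0)) ?_ ?_) (by simpa using h1)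
  · rw [single_var]; exact (Fml.subst_var _).2
  · rw [single_var, (Fml.subst_var _).1]; exact .id (by simp)

/-- Both sides of the equivalence avoid the fresh variable `t`, so `t = 0` may be assumed. The
universal ghost axiom carries safety to the system with clock for one direction, and the existential
one brings it back for the other. -/
theorem derivable_completeness (R : DiffRadicals L) {sys : ODE S} (hsys : sys.WF) {Q : SA S}
    (hQ : Q.DiffFree) {e : Term S} (he : e.DiffFree) {D : NF S} (hD : D.IsNormalFormOf L Q) :
    Derivable L [] (.iff (.box (.ode sys Q) (.eq e (.const 0)))
      (.imp Q.toFml (.and (.eq e (.const 0))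
        (.imp (R.progress sys D) (R.radical sys e))))) := by
  obtain ⟨A, hA, hfresh⟩ := D.exists_finite_fresh
  set B : Fml S := .box (.ode sys Q) (.eq e (.const 0)) with hB
  set C : Fml S := .imp Q.toFml (.and (.eq e (.const 0))
    (.imp (R.progress sys D) (R.radical sys e))) with hC
  obtain ⟨t, htl, htA⟩ := exists_fresh sys.lhs (((((hA.union B.fv_finite).union
    C.fv_finite).union e.fv_finite).union sys.rhsFv_finite).union Q.fv_finite)
  simp only [Set.mem_union, not_or] at htA
  obtain ⟨⟨⟨⟨⟨htD, htB⟩, htC⟩, hte⟩, hts⟩, htQ⟩ := htA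
  have hext := hsys.clockExtension (L := L) htl hts
  have hprime : ((t, 1) : Var) ∉ e.fv := fun h => by simpa using he.snd_eq_zero _ h
  have hprime' : ∀ i ∈ sys.lhs, ((i, 1) : Var) ∉ (Fml.eq e (.const 0)).fv := fun i _ hi =>
    hi.elim (fun hi => by simpa using he.snd_eq_zero _ hi) id
  have hBC : Derivable L [B] C := by
    refine derivable_of_fresh_eq (x := (t, 0)) (c := .const 0) (Set.notMem_empty _)
      (by simpa using htB) htC (derivable_of_forall_world fun W hW => ?_)
    have ht : W.val (.var (t, 0)) = 0 := W.mem_eq.1 (hW _ (by simp))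
    have hBW : B ∈ W := hW _ (by simp)
    rw [hC, World.mem_imp, World.mem_and, World.mem_imp]
    refine fun hQW => ⟨((W.mem_box_ode hsys hQ hprime').1 hBW hQW).1, fun hp => ?_⟩
    refine hext.radical_mem R W ht he hte hQ hD (hfresh _ htD) ?_ hQW hp
    exact W.box_append_ghost hsys hQ trivial trivial htl
      (by simp [Term.fv, Fml.fv, hts, htQ, hte]) (by simp [Term.fv, Fml.fv, hprime]) hBW
  have hCB : Derivable L [C] B := by
    refine derivable_box_of_ghost (y := t) (a := .const 0) (b := .const 1) 0 hsys hQ trivial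
      trivial htl (by simp [Term.fv, Fml.fv, hts, htQ, hte]) (by simp [Term.fv, Fml.fv, hprime])
      (by simpa using htC) (derivable_of_forall_world fun W hW => ?_)
    have hCW : C ∈ W := hW _ (by simp)
    rw [hC, World.mem_imp, World.mem_and, World.mem_imp, World.mem_eq] at hCW
    exact hext.box_mem R W (W.mem_eq.1 (hW _ (by simp))) he hte hQ hD (hfresh _ htD) hCW
  exact .andR (.impR hBC) (.impR hCB)

end DL

end

theorem mainTheorem9 {S : DL.Signature} {L : DL.ExtLang S} (R : DL.DiffRadicals L)
    (sys : DL.ODE S) (hsys : sys.WF) (Q : DL.SA S) (hQ : Q.DiffFree)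
    (e : DL.Term S) (he : e.DiffFree) :
    (∃ D : DL.NF S, D.IsNormalFormOf L Q) ∧
    ∀ D : DL.NF S, D.IsNormalFormOf L Q →
      DL.Derivable L []
        (.iff (.box (.ode sys Q) (.eq e (.const 0)))
          (.imp Q.toFml (.and (.eq e (.const 0))
            (.imp (R.progress sys D) (R.radical sys e))))) := by
  obtain ⟨D, hD, h⟩ := (Q.exists_nf (L := L) hQ).1
  exact ⟨⟨D, DL.NF.isNormalFormOf_of_forall_world hD fun W => (h W).symm⟩,
    fun D hD => DL.derivable_completeness R hsys hQ he hD⟩
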